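/- Let $G$ be a Lie group acting smoothly and transitively on a (Hausdorff) manifold $M=G/H$, where $H$ is the isotropy group of an origin $p$ and the projection $\pi:G\to M$, $\sigma\mapsto\sigma p$, is a submersion. Let $\mathfrak g=\mathfrak h+\mathfrak m$ be a reductive decomposition ($\mathfrak h$ the Lie algebra of $H$, $\mathfrak m$ an $\mathrm{Ad}(H)$-invariant complement, identified with $T_pM$ by $d\pi$), let $\mathfrak m=\bigoplus_{i=1}^s\mathfrak m_i$ be a decomposition into $\mathrm{Ad}(H)$-irreducible subspaces, and let $\alpha_i$ be an $\mathrm{Ad}(H)$-invariant scalar product on $\mathfrak m_i$. For $c=(c_1,\dots,c_s)$ with all $c_i>0$, let $g(c)$ be the $G$-invariant Riemannian metric on $M$ that is given at $p$ by the scalar product $\sum_i c_i\alpha_i$ on $\mathfrak m$; the metrics $g(c)$ form a family of positively related metrics. A $G$-invariant Finsler metric (in particular, a $G$-invariant Riemannian metric) on $M$ is called a *geodesic orbit metric* if each of its geodesics $\gamma$ is an orbit of a one-parameter subgroup of $G$, that is, $\gamma(t)=\varphi(t)q$ for a smooth homomorphism $\varphi:\mathbb R\to G$ and a point $q\in M$.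 Geodesics are the regular curves with $D_{\dot\gamma}\dot\gamma=0$ for the Chern connection with reference vector $\dot\gamma$. Let $L:[0,\infty)^k\to\mathbb R$ be continuous and positively homogeneous of degree $2$, and suppose that on $(0,\infty)^k$ it is smooth and positive, $L_{,j}\ge 0$ for $j=1,\dots,k$, the Hessian of $L$ is positive semi-definite, and $L_{,1}+\dots+L_{,k}>0$. **Theorem.** Suppose that every metric $g(c)$, $c\in(0,\infty)^s$, of the family of positively related metrics is a geodesic orbit metric. Let $g_1,\dots,g_k$ be metrics of this family, $g_j=\sum_{i=1}^s a_{ji}\alpha_i$ on $\mathfrak m$ with $a_{ji}>0$. Then $$F=\sqrt{L(\sqrt{g_1},\dots,\sqrt{g_k})}$$ is a $G$-invariant Finsler metric on $M$ and a geodesic orbit metric. Moreover, $F$ is of the $\alpha_i$-type: there is a function $f:[0,\infty)^s\to\mathbb R$, continuous, and smooth away from the origin, such that $F(y)=f(\alpha_1(y_1,y_1),\dots,\alpha_s(y_s,y_s))$ for all $y=y_1+\dots+y_s\in\mathfrak m$, $y_i\in\mathfrak m_i$. -/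

import Mathlib

open Set
open scoped Manifold ContDiff

namespace GOFinsler

noncomputable section

/-! ### Finsler metrics on a manifold -/

section Finsler

variable {E : Type*} [NormedAddCommGroup E] [NormedSpace ℝ E]
  {M : Type*} [TopologicalSpace M] [ChartedSpace E M]

/-- The fundamental tensor
`g_v(u, w) = 1/2 * ∂²/∂s∂t F²(v + s u + t w)` at `s = t = 0`. -/
def fundamentalTensor (F : ∀ x : M, TangentSpace 𝓘(ℝ, E) x → ℝ) (x : M)
    (v u w : TangentSpace 𝓘(ℝ, E) x) : ℝ :=
  (1 / 2) * deriv (fun a : ℝ => deriv (fun b : ℝ => F x (v + a • u + b • w) ^ 2) 0) 0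

/-- `F` is a Finsler metric: smooth off the zero section of the tangent bundle and, in each
tangent space, a Minkowski norm (positive, positively homogeneous, with positive definite
fundamental tensor). -/
structure IsFinslerMetric [IsManifold 𝓘(ℝ, E) ∞ M]
    (F : ∀ x : M, TangentSpace 𝓘(ℝ, E) x → ℝ) : Prop where
  smooth : ContMDiffOn 𝓘(ℝ, E).tangent 𝓘(ℝ, ℝ) ∞
    (fun X : TangentBundle 𝓘(ℝ, E) M => F X.proj X.snd) {X | X.snd ≠ 0}
  pos : ∀ (x : M) (v : TangentSpace 𝓘(ℝ, E) x), v ≠ 0 → 0 < F x v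
  homogeneous : ∀ (x : M) (v : TangentSpace 𝓘(ℝ, E) x) (c : ℝ), 0 < c → F x (c • v) = c * F x v
  strongly_convex : ∀ (x : M) (v w : TangentSpace 𝓘(ℝ, E) x), v ≠ 0 → w ≠ 0 →
    0 < fundamentalTensor F x v w w

/-- The tangent vector at the point with coordinates `z` in the chart at `c` whose
components in that chart are `v`. -/
def chartVector (c : M) (z v : E) :
    TangentSpace 𝓘(ℝ, E) ((extChartAt 𝓘(ℝ, E) c).symm z) :=
  mfderiv 𝓘(ℝ, E) 𝓘(ℝ, E) (extChartAt 𝓘(ℝ, E) c).symm z v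

/-- The fundamental tensor in the chart at `c`:
`chartTensor F c z v u w = g_{ij}(z, v) u^i w^j`. -/
def chartTensor (F : ∀ x : M, TangentSpace 𝓘(ℝ, E) x → ℝ) (c : M) (z v u w : E) : ℝ :=
  fundamentalTensor F ((extChartAt 𝓘(ℝ, E) c).symm z)
    (chartVector c z v) (chartVector c z u) (chartVector c z w)

/-- `γ` is a geodesic of `F` on the set `J` of parameters: a regular curve whose velocity field
is parallel along it for the Chern connection, with the velocity as reference vector. In a
chart, with `x = x(t)` the coordinates of `γ`, the equation `x''ⁱ + Γⁱ_{jk}(x, x') x'ʲ x'ᵏ = 0`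
reads, after lowering the index with `g(x, x')` and contracting with an arbitrary vector `w`,
`g_{il} x''ⁱ wˡ + ∂_k g_{jl} x'ʲ x'ᵏ wˡ - 1/2 ∂_l g_{jk} x'ʲ x'ᵏ wˡ = 0`,
all `g_{ij}` and their position derivatives being taken at `(x, x')`. (The terms of the Chern
connection coefficients that contain the Cartan tensor and the nonlinear connection vanish
when contracted with `x'ʲ x'ᵏ`.) For `F = √g` with `g` Riemannian this is the usual
geodesic equation. -/
structure IsGeodesicOn (F : ∀ x : M, TangentSpace 𝓘(ℝ, E) x → ℝ) (γ : ℝ → M) (J : Set ℝ) :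
    Prop where
  smooth : ContMDiffOn 𝓘(ℝ, ℝ) 𝓘(ℝ, E) 2 γ J
  regular : ∀ t ∈ J, mfderiv 𝓘(ℝ, ℝ) 𝓘(ℝ, E) γ t ≠ 0
  equation : ∀ c : M, ∀ t ∈ J, γ t ∈ (extChartAt 𝓘(ℝ, E) c).source → ∀ w : E,
    let x : ℝ → E := fun r => extChartAt 𝓘(ℝ, E) c (γ r)
    let x' : E := deriv x t
    let x'' : E := deriv (deriv x) t
    chartTensor F c (x t) x' x'' w
      + fderiv ℝ (fun z => chartTensor F c z x' x' w) (x t) x'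
      - (1 / 2) * fderiv ℝ (fun z => chartTensor F c z x' x' x') (x t) w = 0

/-- The norm `√g` of a Riemannian metric `g`, as a function on the tangent bundle. -/
def riemannianNorm [IsManifold 𝓘(ℝ, E) ∞ M]
    (g : Bundle.ContMDiffRiemannianMetric 𝓘(ℝ, E) ∞ E (TangentSpace 𝓘(ℝ, E) (M := M))) :
    ∀ x : M, TangentSpace 𝓘(ℝ, E) x → ℝ :=
  fun x v => Real.sqrt (g.inner x v v)

/-- The function `√(L(√g₁, …, √g_k))` on the tangent bundle. -/
def combinedMetric [IsManifold 𝓘(ℝ, E) ∞ M] {k : ℕ} (L : (Fin k → ℝ) → ℝ)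
    (g : Fin k →
      Bundle.ContMDiffRiemannianMetric 𝓘(ℝ, E) ∞ E (TangentSpace 𝓘(ℝ, E) (M := M))) :
    ∀ x : M, TangentSpace 𝓘(ℝ, E) x → ℝ :=
  fun x v => Real.sqrt (L fun j => riemannianNorm (g j) x v)

end Finsler

/-- The conditions on the function `L` of `k` nonnegative variables: continuous, smooth and
positive, positively homogeneous of degree 2, with nonnegative partial derivatives, positive
semi-definite Hessian and positive sum of the partial derivatives. Nonzero vectors have
positive norms, so only the values of `L` and its derivatives at points with all
coordinates positive are constrained, besides continuity and homogeneity on `[0, ∞)^k`. -/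
structure IsAdmissible {k : ℕ} (L : (Fin k → ℝ) → ℝ) : Prop where
  continuous : ContinuousOn L {t | ∀ j, 0 ≤ t j}
  smooth : ContDiffOn ℝ ∞ L {t | ∀ j, 0 < t j}
  pos : ∀ t : Fin k → ℝ, (∀ j, 0 < t j) → 0 < L t
  homogeneous : ∀ (t : Fin k → ℝ) (c : ℝ), (∀ j, 0 ≤ t j) → 0 < c → L (c • t) = c ^ 2 * L t
  partial_nonneg : ∀ t : Fin k → ℝ, (∀ j, 0 < t j) → ∀ j, 0 ≤ fderiv ℝ L t (Pi.single j 1)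
  hessian_nonneg : ∀ t : Fin k → ℝ, (∀ j, 0 < t j) → ∀ w : Fin k → ℝ,
    0 ≤ fderiv ℝ (fderiv ℝ L) t w w
  partial_sum_pos : ∀ t : Fin k → ℝ, (∀ j, 0 < t j) → 0 < ∑ j, fderiv ℝ L t (Pi.single j 1)

/-! ### Homogeneous spaces

A Lie group `G` acts smoothly and transitively on `M`; with the origin `p : M` and
`H = MulAction.stabilizer G p`, the manifold `M` is `G/H`, the projection `π : G → G/H` being
`σ ↦ σ • p`. -/

section Homogeneous

variable {EG : Type*} [NormedAddCommGroup EG] [NormedSpace ℝ EG]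
  {E : Type*} [NormedAddCommGroup E] [NormedSpace ℝ E]
  {G : Type*} [TopologicalSpace G] [ChartedSpace EG G] [Group G]
  {M : Type*} [TopologicalSpace M] [ChartedSpace E M] [MulAction G M]

/-- The differential at the identity of the projection `σ ↦ σ • p`, a map `𝔤 → T_p M`. -/
def projDeriv (p : M) : GroupLieAlgebra 𝓘(ℝ, EG) G →L[ℝ] TangentSpace 𝓘(ℝ, E) p :=
  (mfderiv 𝓘(ℝ, EG) 𝓘(ℝ, E) (fun σ : G => σ • p) 1 :)

/-- The adjoint representation `Ad : G → GL(𝔤)`. -/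
def Ad (σ : G) : GroupLieAlgebra 𝓘(ℝ, EG) G →L[ℝ] GroupLieAlgebra 𝓘(ℝ, EG) G :=
  (mfderiv 𝓘(ℝ, EG) 𝓘(ℝ, EG) (fun τ : G => σ * τ * σ⁻¹) 1 :)

/-- `W` is an `Ad(H)`-invariant subspace, `H` the isotropy group of `p`. -/
def IsAdInvariant (p : M) (W : Submodule ℝ (GroupLieAlgebra 𝓘(ℝ, EG) G)) : Prop :=
  ∀ σ ∈ MulAction.stabilizer G p, ∀ v ∈ W, Ad σ v ∈ W

variable (EG E G) in
/-- The Lie algebra `𝔥` of the isotropy group `H` of `p`: the kernel of the differential of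
`σ ↦ σ • p` at the identity. -/
def isotropyAlgebra (p : M) : Submodule ℝ (GroupLieAlgebra 𝓘(ℝ, EG) G) :=
  LinearMap.ker (projDeriv (EG := EG) (E := E) (G := G) p).toLinearMap

variable (E) in
/-- `𝔤 = 𝔥 + 𝔪` is a reductive decomposition. -/
structure IsReductiveComplement (p : M) (𝔪 : Submodule ℝ (GroupLieAlgebra 𝓘(ℝ, EG) G)) :
    Prop where
  isCompl : IsCompl (isotropyAlgebra EG E G p) 𝔪
  invariant : IsAdInvariant p 𝔪

/-- `𝔪 = ⊕ 𝔪ᵢ` with `Ad(H)`-irreducible `𝔪ᵢ`. -/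
structure IsIrreducibleDecomposition (p : M) (𝔪 : Submodule ℝ (GroupLieAlgebra 𝓘(ℝ, EG) G))
    {s : ℕ} (𝔪i : Fin s → Submodule ℝ (GroupLieAlgebra 𝓘(ℝ, EG) G)) : Prop where
  iSup_eq : ⨆ i, 𝔪i i = 𝔪
  independent : iSupIndep 𝔪i
  invariant : ∀ i, IsAdInvariant p (𝔪i i)
  ne_bot : ∀ i, 𝔪i i ≠ ⊥
  irreducible : ∀ i, ∀ W : Submodule ℝ (GroupLieAlgebra 𝓘(ℝ, EG) G),
    IsAdInvariant p W → W ≤ 𝔪i i → W = ⊥ ∨ W = 𝔪i i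

/-- `α` is an `Ad(H)`-invariant scalar product on the subspace `W`. -/
structure IsInvariantScalarProduct (p : M) {W : Submodule ℝ (GroupLieAlgebra 𝓘(ℝ, EG) G)}
    (α : W →ₗ[ℝ] W →ₗ[ℝ] ℝ) : Prop where
  symm : ∀ u v : W, α u v = α v u
  pos : ∀ u : W, u ≠ 0 → 0 < α u u
  invariant : ∀ σ ∈ MulAction.stabilizer G p, ∀ u v u' v' : W,
    Ad σ (u : GroupLieAlgebra 𝓘(ℝ, EG) G) = u' → Ad σ (v : GroupLieAlgebra 𝓘(ℝ, EG) G) = v' →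
      α u' v' = α u v

variable (G) in
/-- `F` is `G`-invariant: `F_{σ q}(σ_* v) = F_q(v)`. -/
def IsInvariantMetric (F : ∀ x : M, TangentSpace 𝓘(ℝ, E) x → ℝ) : Prop :=
  ∀ (σ : G) (x : M) (v : TangentSpace 𝓘(ℝ, E) x),
    F (σ • x) (mfderiv 𝓘(ℝ, E) 𝓘(ℝ, E) (fun y : M => σ • y) x v) = F x v

variable (EG G) in
/-- `(G/H, F)` is a geodesic orbit space: every geodesic, defined on any open interval, is an
orbit of a one-parameter subgroup of `G`. -/
def IsGeodesicOrbit (F : ∀ x : M, TangentSpace 𝓘(ℝ, E) x → ℝ) : Prop :=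
  ∀ (γ : ℝ → M) (J : Set ℝ), IsOpen J → J.OrdConnected → IsGeodesicOn F γ J →
    ∃ (φ : Multiplicative ℝ →* G) (q : M),
      ContMDiff 𝓘(ℝ, ℝ) 𝓘(ℝ, EG) ∞ (fun t : ℝ => φ (Multiplicative.ofAdd t)) ∧
      ∀ t ∈ J, γ t = φ (Multiplicative.ofAdd t) • q

/-- The `G`-invariant Riemannian metric `g` on `G/H` is the one given by the scalar product
`∑ᵢ aᵢ αᵢ` on `𝔪 = ⊕ 𝔪ᵢ ≅ T_p M`. -/
structure IsDiagonalMetric [IsManifold 𝓘(ℝ, E) ∞ M] (p : M) {s : ℕ}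
    {𝔪i : Fin s → Submodule ℝ (GroupLieAlgebra 𝓘(ℝ, EG) G)}
    (α : ∀ i, 𝔪i i →ₗ[ℝ] 𝔪i i →ₗ[ℝ] ℝ) (a : Fin s → ℝ)
    (g : Bundle.ContMDiffRiemannianMetric 𝓘(ℝ, E) ∞ E (TangentSpace 𝓘(ℝ, E) (M := M))) :
    Prop where
  invariant : IsInvariantMetric G (riemannianNorm g)
  inner_eq : ∀ y z : (∀ i, 𝔪i i),
    g.inner p (projDeriv p (∑ i, (y i : GroupLieAlgebra 𝓘(ℝ, EG) G)))
      (projDeriv p (∑ i, (z i : GroupLieAlgebra 𝓘(ℝ, EG) G))) = ∑ i, a i * α i (y i) (z i)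

/-- The invariant metric `F` is of the `αᵢ`-type for the given scalar products `αᵢ`:
`F(y) = f(α₁(y₁, y₁), …, α_s(y_s, y_s))` on `𝔪`, with `f` continuous on `[0, ∞)^s` and
smooth there away from the origin. -/
def IsAlphaType (p : M) {s : ℕ}
    {𝔪i : Fin s → Submodule ℝ (GroupLieAlgebra 𝓘(ℝ, EG) G)}
    (α : ∀ i, 𝔪i i →ₗ[ℝ] 𝔪i i →ₗ[ℝ] ℝ) (F : ∀ x : M, TangentSpace 𝓘(ℝ, E) x → ℝ) : Prop :=
  ∃ f : (Fin s → ℝ) → ℝ,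
    ContinuousOn f {r | ∀ i, 0 ≤ r i} ∧
    ContDiffOn ℝ ∞ f ({r | ∀ i, 0 ≤ r i} \ {0}) ∧
    ∀ y : (∀ i, 𝔪i i),
      F p (projDeriv p (∑ i, (y i : GroupLieAlgebra 𝓘(ℝ, EG) G)))
        = f (fun i => α i (y i) (y i))

end Homogeneous

end

end GOFinsler

namespace GOFinsler

open Filter Topology

/-! Write `F²` as `Λ(g₁, …, g_k)` with `Λ(r) = L(√r₁, …, √r_k)`. Fix a nonzero vector `v`, let `c_j`
be the partial derivatives of `Λ` at the numbers `g_j(v, v)`, and let `ĝ = ∑ c_j g_j` be the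
osculating Riemannian metric. The `c_j` are nonnegative and not all zero, so `ĝ` is a metric of the
family, and its geodesic with initial velocity `v` is an orbit `φ(t) q`. This orbit is also a
geodesic of `F`. Each `g_j` is invariant, so the energy `g_j` is constant along the orbit. In the
Euler–Lagrange expression of `Λ(g₁, …, g_k)` the term with the second derivatives of `Λ` contains
the rate of change of these energies along the motion, hence vanishes; what remains is the
Euler–Lagrange expression of `∑ c_j g_j`, which is zero at the initial time (`eulerLagrangeAt_comp`,
`IsFinslerMetric.fderiv_chartEnergy_orbit`). Translation along the orbit by isometries carries the
equation from the initial time to all times (`IsFinslerMetric.isGeodesicOn_orbit`). By uniqueness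
(`IsFinslerMetric.geodesic_eqOn`), every geodesic of `F` is such an orbit. To use this argument, the
Chern geodesic equation is rewritten as the Euler–Lagrange equation of `F²` in a chart
(`IsFinslerMetric.geodesic_equation_iff`). Strong convexity of `F` comes from
`IsAdmissible.deriv_deriv_pos`: the Hessian of `L` contributes a nonnegative term, and strict
Cauchy–Schwarz for the `g_j` together with a positive partial derivative of `L` contributes a
positive one. -/

lemma apply_eq_sum_single {k : ℕ} (T : (Fin k → ℝ) →L[ℝ] ℝ) (x : Fin k → ℝ) :
    T x = ∑ j, T (Pi.single j 1) * x j := by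
  conv_lhs => rw [← Finset.univ_sum_single x]
  rw [map_sum]
  refine Finset.sum_congr rfl fun j _ => ?_
  rw [show Pi.single j (x j) = x j • (Pi.single j (1 : ℝ) : Fin k → ℝ) by
    rw [← Pi.single_smul]; simp, map_smul, smul_eq_mul, mul_comm]

/-! ### Euler–Lagrange equations on the phase space `E × E`. -/

section EulerLagrange

variable {E : Type*} [NormedAddCommGroup E] [NormedSpace ℝ E]
  {E' : Type*} [NormedAddCommGroup E'] [NormedSpace ℝ E']

/-- The Euler–Lagrange equation of the Lagrangian `e (position, velocity)` for the acceleration `a`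
at the point `p` of the phase space. -/
def EulerLagrangeAt (e : E × E → ℝ) (p : E × E) (a : E) : Prop :=
  ∀ w : E, fderiv ℝ (fderiv ℝ e) p (p.2, a) (0, w) = fderiv ℝ e p (w, 0)

lemma hasFDerivAt_fderiv {F : Type*} [NormedAddCommGroup F] [NormedSpace ℝ F]
    {f : E → F} {p : E} (h : ContDiffAt ℝ ∞ f p) :
    HasFDerivAt (fderiv ℝ f) (fderiv ℝ (fderiv ℝ f) p) p :=
  ((h.fderiv_right (m := 1) (by norm_cast)).differentiableAt (by norm_num)).hasFDerivAt

lemma eventually_differentiableAt {F : Type*} [NormedAddCommGroup F] [NormedSpace ℝ F]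
    {f : E → F} {p : E} (h : ContDiffAt ℝ ∞ f p) : ∀ᶠ q in 𝓝 p, DifferentiableAt ℝ f q := by
  have h1 : ContDiffAt ℝ 1 f p := h.of_le (by norm_cast)
  filter_upwards [h1.eventually (by simp)] with q hq using hq.differentiableAt (by norm_num)

/-- Euler's identity for a function of degree two in the velocity. -/
lemma fderiv_vertical_self {e : E × E → ℝ} {p : E × E} (he : DifferentiableAt ℝ e p)
    (hom : ∀ c : ℝ, 0 < c → e (p.1, c • p.2) = c ^ 2 * e p) :
    fderiv ℝ e p (0, p.2) = 2 * e p := by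
  have h1 : HasDerivAt (fun c : ℝ => (p.1, c • p.2)) (0, p.2) 1 := by
    have := (hasDerivAt_const (1 : ℝ) p.1).prodMk ((hasDerivAt_id (1 : ℝ)).smul_const p.2)
    simpa using this
  have h2 : HasDerivAt (fun c : ℝ => e (p.1, c • p.2)) (fderiv ℝ e p (0, p.2)) 1 := by
    have h3 : HasFDerivAt e (fderiv ℝ e p) ((fun c : ℝ => (p.1, c • p.2)) 1) := by
      simpa using he.hasFDerivAt
    exact h3.comp_hasDerivAt 1 h1
  have h4 : HasDerivAt (fun c : ℝ => c ^ 2 * e p) (2 * e p) 1 := by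
    simpa using (hasDerivAt_pow 2 (1 : ℝ)).mul_const (e p)
  refine h2.unique (h4.congr_of_eventuallyEq ?_)
  filter_upwards [lt_mem_nhds (one_pos : (0 : ℝ) < 1)] with c hc using hom c hc

/-- Euler's identity holds at all points near `p`. Its vertical derivative contains the first
derivative once on the left and twice on the right; the difference is the claim, after using the
symmetry of the second derivative. -/
lemma fderiv_fderiv_vertical_self {e : E × E → ℝ} {p : E × E} (he : ContDiffAt ℝ ∞ e p)
    (hom : ∀ᶠ q in 𝓝 p, ∀ c : ℝ, 0 < c → e (q.1, c • q.2) = c ^ 2 * e q) (w : E) :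
    fderiv ℝ (fderiv ℝ e) p (0, p.2) (0, w) = fderiv ℝ e p (0, w) := by
  have h1 : (fun q : E × E => fderiv ℝ e q (0, q.2)) =ᶠ[𝓝 p] fun q => 2 * e q := by
    filter_upwards [hom, eventually_differentiableAt he] with q hq hq'
      using fderiv_vertical_self hq' hq
  have hd : DifferentiableAt ℝ e p := he.differentiableAt (by simp)
  have h2 : HasFDerivAt (fun q : E × E => ((0 : E), q.2))
      ((0 : E × E →L[ℝ] E).prod (ContinuousLinearMap.snd ℝ E E)) p :=
    (hasFDerivAt_const (0 : E) p).prodMk hasFDerivAt_snd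
  have h3 := (hasFDerivAt_fderiv he).clm_apply h2
  have h4 := h3.unique ((hd.hasFDerivAt.const_mul 2).congr_of_eventuallyEq h1)
  have h5 := DFunLike.congr_fun h4 (0, w)
  have hs := (he.isSymmSndFDerivAt (by simp; norm_cast)) (0, p.2) (0, w)
  simp at h5
  rw [hs]
  linarith

/-- The lift of a map to the phase space. -/
noncomputable def phaseMap (ψ : E → E') (q : E × E) : E' × E' := (ψ q.1, fderiv ℝ ψ q.1 q.2)

lemma hasFDerivAt_phaseMap {ψ : E → E'} {p : E × E} (h : ContDiffAt ℝ ∞ ψ p.1) :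
    ∃ D : E × E →L[ℝ] E' × E', HasFDerivAt (phaseMap ψ) D p ∧
      ∀ ξ, D ξ = (fderiv ℝ ψ p.1 ξ.1,
        fderiv ℝ (fderiv ℝ ψ) p.1 ξ.1 p.2 + fderiv ℝ ψ p.1 ξ.2) := by
  have h1 : HasFDerivAt (fun q : E × E => ψ q.1) _ p :=
    (h.differentiableAt (by simp)).hasFDerivAt.comp p hasFDerivAt_fst
  have h2 : HasFDerivAt (fun q : E × E => fderiv ℝ ψ q.1) _ p :=
    (hasFDerivAt_fderiv h).comp p hasFDerivAt_fst
  refine ⟨_, h1.prodMk (h2.clm_apply hasFDerivAt_snd), fun ξ => ?_⟩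
  simp [add_comm]

/-- Covariance of the Euler–Lagrange equation under a change of the position variable. -/
lemma EulerLagrangeAt.of_phaseMap {e : E × E → ℝ} {e' : E' × E' → ℝ} {ψ : E → E'} {p : E × E}
    (hψ : ContDiffAt ℝ ∞ ψ p.1) (he' : ContDiffAt ℝ ∞ e' (phaseMap ψ p))
    (hee : e =ᶠ[𝓝 p] fun q => e' (phaseMap ψ q)) {a : E}
    (h : EulerLagrangeAt e' (phaseMap ψ p)
      (fderiv ℝ (fderiv ℝ ψ) p.1 p.2 p.2 + fderiv ℝ ψ p.1 a)) :
    EulerLagrangeAt e p a := by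
  intro w
  have hψ1 : ∀ᶠ q in 𝓝 p, ContDiffAt ℝ 2 ψ q.1 := by
    have : ContDiffAt ℝ 2 ψ p.1 := hψ.of_le (by norm_cast)
    exact continuous_fst.continuousAt.eventually (this.eventually (by simp))
  obtain ⟨D, hD, hD'⟩ := hasFDerivAt_phaseMap hψ
  have hcont : ContinuousAt (phaseMap ψ) p := hD.continuousAt
  -- The chain rule is needed at all nearby points and not only at `p`, because its vertical part is
  -- differentiated once more.
  have key : ∀ᶠ q in 𝓝 p, ∀ a b : E, fderiv ℝ e q (a, b) = fderiv ℝ e' (phaseMap ψ q)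
      (fderiv ℝ ψ q.1 a, fderiv ℝ (fderiv ℝ ψ) q.1 a q.2 + fderiv ℝ ψ q.1 b) := by
    have hψ2 : ∀ᶠ q in 𝓝 p, DifferentiableAt ℝ ψ q.1 ∧ DifferentiableAt ℝ (fderiv ℝ ψ) q.1 := by
      filter_upwards [hψ1] with q hq
      exact ⟨hq.differentiableAt (by norm_num),
        (hq.fderiv_right (m := 1) (by norm_num)).differentiableAt (by norm_num)⟩
    filter_upwards [hee.eventuallyEq_nhds, hψ2,
      hcont.eventually (eventually_differentiableAt he')] with q hq hq2 hq3 a b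
    have h1 : HasFDerivAt (fun q : E × E => ψ q.1) _ q :=
      hq2.1.hasFDerivAt.comp q hasFDerivAt_fst
    have h2 : HasFDerivAt (fun q : E × E => fderiv ℝ ψ q.1) _ q :=
      hq2.2.hasFDerivAt.comp q hasFDerivAt_fst
    have h3 := h1.prodMk (h2.clm_apply hasFDerivAt_snd)
    have h4 : HasFDerivAt (fun q => e' (phaseMap ψ q)) _ q := hq3.hasFDerivAt.comp q h3
    rw [hq.fderiv_eq, h4.fderiv]
    simp [add_comm]
  have key1 : (fun q : E × E => fderiv ℝ e q (0, w)) =ᶠ[𝓝 p] fun q =>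
      fderiv ℝ e' (phaseMap ψ q) (0, fderiv ℝ ψ q.1 w) := by
    filter_upwards [key] with q hq
    simpa using hq 0 w
  have he : ContDiffAt ℝ ∞ e p := by
    refine ContDiffAt.congr_of_eventuallyEq (he'.comp p ?_) hee
    unfold phaseMap
    exact (hψ.comp p contDiffAt_fst).prodMk
      (((hψ.fderiv_right (m := ∞) (by simp)).comp p contDiffAt_fst).clm_apply contDiffAt_snd)
  have l1 := (hasFDerivAt_fderiv he).clm_apply (hasFDerivAt_const ((0 : E), w) p)
  have l2 : HasFDerivAt (fun q => fderiv ℝ e' (phaseMap ψ q)) _ p :=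
    (hasFDerivAt_fderiv he').comp p hD
  have l3 : HasFDerivAt (fun q : E × E => fderiv ℝ ψ q.1) _ p :=
    (hasFDerivAt_fderiv hψ).comp p hasFDerivAt_fst
  have l4 := l2.clm_apply ((hasFDerivAt_const (0 : E') p).prodMk
    (l3.clm_apply (hasFDerivAt_const w p)))
  have l5 := DFunLike.congr_fun (l1.unique (l4.congr_of_eventuallyEq key1)) (p.2, a)
  have hw := h (fderiv ℝ ψ p.1 w)
  have kw := key.self_of_nhds w 0
  -- The terms with the second derivative of `ψ` on the two sides have their arguments `p.2` and `w`
  -- interchanged; symmetry makes them cancel.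
  have hs := (hψ.isSymmSndFDerivAt (by simp; norm_cast)) p.2 w
  simp [hD'] at l5 kw
  rw [l5, kw, hs]
  rw [show (fderiv ℝ ψ p.1 w, fderiv ℝ (fderiv ℝ ψ) p.1 w p.2)
    = (fderiv ℝ ψ p.1 w, (0 : E')) + (0, fderiv ℝ (fderiv ℝ ψ) p.1 w p.2) by simp, map_add, ← hw]
  simp [phaseMap, add_comm]

/-- The Euler–Lagrange equation of a function of several Lagrangians that are stationary in the
direction of motion is that of the osculating linear combination. -/
lemma eulerLagrangeAt_comp {k : ℕ} {e : Fin k → E × E → ℝ} {p : E × E} {Λ : (Fin k → ℝ) → ℝ}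
    (he : ∀ j, ContDiffAt ℝ ∞ (e j) p) (hΛ : ContDiffAt ℝ ∞ Λ fun j => e j p) {a : E}
    (hstat : ∀ j, fderiv ℝ (e j) p (p.2, a) = 0)
    (h : EulerLagrangeAt (fun q => ∑ j, fderiv ℝ Λ (fun j => e j p) (Pi.single j 1) * e j q) p a) :
    EulerLagrangeAt (fun q => Λ fun j => e j q) p a := by
  intro w
  set c : Fin k → ℝ := fun j => fderiv ℝ Λ (fun j => e j p) (Pi.single j 1)
  have hep : ∀ᶠ q in 𝓝 p, ∀ j, DifferentiableAt ℝ (e j) q :=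
    eventually_all.2 fun j => eventually_differentiableAt (he j)
  have hc : ContinuousAt (fun q => fun j => e j q) p :=
    continuousAt_pi.2 fun j => (he j).continuousAt
  have k1 : fderiv ℝ (fun q => Λ fun j => e j q) =ᶠ[𝓝 p] fun q =>
      (fderiv ℝ Λ fun j => e j q).comp (ContinuousLinearMap.pi fun j => fderiv ℝ (e j) q) := by
    filter_upwards [hep, hc.eventually (eventually_differentiableAt hΛ)] with q hq hq'
    exact (hq'.hasFDerivAt.comp q (hasFDerivAt_pi.2 fun j => (hq j).hasFDerivAt)).fderiv
  have k2 : fderiv ℝ (fun q => ∑ j, c j * e j q) =ᶠ[𝓝 p] fun q =>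
      ∑ j, c j • fderiv ℝ (e j) q := by
    filter_upwards [hep] with q hq
    exact (HasFDerivAt.fun_sum fun j _ => (hq j).hasFDerivAt.const_mul (c j)).fderiv
  have hpi : HasFDerivAt (fun q => fun j => e j q)
      (ContinuousLinearMap.pi fun j => fderiv ℝ (e j) p) p :=
    hasFDerivAt_pi.2 fun j => ((he j).differentiableAt (by simp)).hasFDerivAt
  have m1 : HasFDerivAt (fun q => fderiv ℝ Λ fun j => e j q) _ p :=
    (hasFDerivAt_fderiv hΛ).comp p hpi
  have m2 : HasFDerivAt (fun q => fun j => fderiv ℝ (e j) q (0, w)) _ p :=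
    hasFDerivAt_pi.2 fun j =>
      (hasFDerivAt_fderiv (he j)).clm_apply (hasFDerivAt_const ((0 : E), w) p)
  have m3 := m1.clm_apply m2
  have he0 : ContDiffAt ℝ ∞ (fun q => Λ fun j => e j q) p :=
    hΛ.comp p (contDiffAt_pi.2 he)
  have m4 := (hasFDerivAt_fderiv he0).clm_apply (hasFDerivAt_const ((0 : E), w) p)
  have k1' : (fun q => fderiv ℝ (fun q => Λ fun j => e j q) q (0, w)) =ᶠ[𝓝 p] fun q =>
      (fderiv ℝ Λ fun j => e j q) fun j => fderiv ℝ (e j) q (0, w) := by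
    filter_upwards [k1] with q hq
    rw [hq]; rfl
  have m5 := DFunLike.congr_fun (m4.unique (m3.congr_of_eventuallyEq k1')) (p.2, a)
  -- Stationarity removes the term with the second derivative of `Λ`, the only one by which the
  -- equation differs from that of the linear combination with frozen coefficients `c`.
  have hpz : (ContinuousLinearMap.pi fun j => fderiv ℝ (e j) p) (p.2, a) = 0 := by
    ext j; simp [hstat]
  have he1 : ContDiffAt ℝ ∞ (fun q => ∑ j, c j * e j q) p :=
    ContDiffAt.sum fun j _ => contDiffAt_const.mul (he j)
  have n2 : HasFDerivAt (fun q => ∑ j, c j • fderiv ℝ (e j) q) _ p :=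
    HasFDerivAt.fun_sum fun j _ => (hasFDerivAt_fderiv (he j)).const_smul (c j)
  have n3 := (hasFDerivAt_fderiv he1).unique (n2.congr_of_eventuallyEq k2)
  have hw := h w
  rw [n3, k2.self_of_nhds] at hw
  rw [k1.self_of_nhds]
  simp [hpz] at m5 hw
  rw [m5, ContinuousLinearMap.comp_apply, apply_eq_sum_single,
    apply_eq_sum_single _ ((ContinuousLinearMap.pi _) _)]
  simpa [c] using hw

end EulerLagrange

/-! ### Local existence and uniqueness for regular Lagrangians. -/

section Spray

variable {E : Type*} [NormedAddCommGroup E] [NormedSpace ℝ E] [FiniteDimensional ℝ E]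

/-- A regular Lagrangian has a spray: its Euler–Lagrange equation can be solved for the
acceleration. -/
lemma exists_spray {e : E × E → ℝ} {p : E × E} (he : ContDiffAt ℝ ∞ e p)
    (hpos : ∀ w : E, w ≠ 0 → 0 < fderiv ℝ (fderiv ℝ e) p (0, w) (0, w)) :
    ∃ S : E × E → E, ContDiffAt ℝ 1 S p ∧
      ∀ᶠ q in 𝓝 p, ∀ a, EulerLagrangeAt e q a ↔ a = S q := by
  have := FiniteDimensional.complete ℝ E
  let inl : E →L[ℝ] E × E := ContinuousLinearMap.inl ℝ E E
  let inr : E →L[ℝ] E × E := ContinuousLinearMap.inr ℝ E E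
  let R : (E × E →L[ℝ] ℝ) →L[ℝ] (E →L[ℝ] ℝ) := (ContinuousLinearMap.compL ℝ E (E × E) ℝ).flip inr
  -- The Euler–Lagrange equation is affine in the acceleration and reads `A q a = B q`, where `A` is
  -- the vertical Hessian.
  let A : E × E → E →L[ℝ] (E →L[ℝ] ℝ) := fun q => R.comp ((fderiv ℝ (fderiv ℝ e) q).comp inr)
  let B : E × E → (E →L[ℝ] ℝ) := fun q =>
    (fderiv ℝ e q).comp inl - R (fderiv ℝ (fderiv ℝ e) q (inl q.2))
  have hd1 : ContDiffAt ℝ ∞ (fderiv ℝ e) p := he.fderiv_right (by simp)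
  have hd2 : ContDiffAt ℝ ∞ (fderiv ℝ (fderiv ℝ e)) p := hd1.fderiv_right (by simp)
  have hA : ContDiffAt ℝ ∞ A p := contDiffAt_const.clm_comp (hd2.clm_comp contDiffAt_const)
  have hB : ContDiffAt ℝ ∞ B p :=
    (hd1.clm_comp contDiffAt_const).sub
      (contDiffAt_const.clm_apply (hd2.clm_apply (inl.contDiff.contDiffAt.comp p contDiffAt_snd)))
  have hinj : Function.Injective (A p) := by
    rw [injective_iff_map_eq_zero]
    intro w hw
    by_contra hne
    have := DFunLike.congr_fun hw w
    have h2 := hpos w hne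
    simp [A, R, inr] at this
    linarith
  have hrank : Module.finrank ℝ E = Module.finrank ℝ (E →L[ℝ] ℝ) := by
    rw [← (LinearMap.toContinuousLinearMap : (E →ₗ[ℝ] ℝ) ≃ₗ[ℝ] (E →L[ℝ] ℝ)).finrank_eq]
    exact (Subspace.dual_finrank_eq (K := ℝ) (V := E)).symm
  let Ae : E ≃L[ℝ] (E →L[ℝ] ℝ) :=
    (LinearEquiv.ofInjectiveOfFinrankEq (A p).toLinearMap hinj hrank).toContinuousLinearEquiv
  have hAe : (Ae : E →L[ℝ] (E →L[ℝ] ℝ)) = A p := by ext; rfl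
  have hinv : ContDiffAt ℝ ∞ (fun q => (A q).inverse) p := by
    have h1 : ContDiffAt ℝ ∞ ContinuousLinearMap.inverse (A p) := by
      rw [← hAe]; exact contDiffAt_map_inverse Ae
    exact h1.comp p hA
  refine ⟨fun q => (A q).inverse (B q), (hinv.clm_apply hB).of_le (by norm_cast), ?_⟩
  -- Invertibility is an open condition, so the equation can be solved at all points near `p`.
  have hopen : ∀ᶠ q in 𝓝 p, ∃ T : E ≃L[ℝ] (E →L[ℝ] ℝ), (T : E →L[ℝ] (E →L[ℝ] ℝ)) = A q :=
    hA.continuousAt.eventually (by rw [← hAe]; exact ContinuousLinearEquiv.nhds Ae)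
  filter_upwards [hopen] with q ⟨T, hT⟩ a
  have h1 : EulerLagrangeAt e q a ↔ A q a = B q := by
    have hsplit : ∀ w, fderiv ℝ (fderiv ℝ e) q (q.2, a) (0, w)
        = fderiv ℝ (fderiv ℝ e) q (q.2, 0) (0, w) + fderiv ℝ (fderiv ℝ e) q (0, a) (0, w) := by
      intro w
      rw [← add_apply, ← map_add]; simp
    constructor
    · intro h
      ext w
      have := h w
      rw [hsplit] at this
      simp [A, B, R, inl, inr]
      linarith
    · intro h w
      have := DFunLike.congr_fun h w
      simp [A, B, R, inl, inr] at this
      rw [hsplit]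
      linarith
  rw [h1, ← hT, ContinuousLinearMap.inverse_equiv]
  exact T.eq_symm_apply.symm

/-- Picard–Lindelöf for the first-order system `y' = (y.2, S y)`. The set `N` lets the solution be
confined to the region where the Lagrangian is under control. -/
lemma EulerLagrangeAt.exists_solution {e : E × E → ℝ} {p : E × E} (he : ContDiffAt ℝ ∞ e p)
    (hpos : ∀ w : E, w ≠ 0 → 0 < fderiv ℝ (fderiv ℝ e) p (0, w) (0, w))
    {N : Set (E × E)} (hN : N ∈ 𝓝 p) (t₀ : ℝ) :
    ∃ ε > 0, ∃ x : ℝ → E, ContDiffOn ℝ 2 x (Ioo (t₀ - ε) (t₀ + ε)) ∧ x t₀ = p.1 ∧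
      deriv x t₀ = p.2 ∧ ∀ t ∈ Ioo (t₀ - ε) (t₀ + ε), (x t, deriv x t) ∈ N ∧
        EulerLagrangeAt e (x t, deriv x t) (deriv (deriv x) t) := by
  have := FiniteDimensional.complete ℝ E
  obtain ⟨S, hS, hEL⟩ := exists_spray he hpos
  obtain ⟨y, hy0, ε, hε, hy⟩ :=
    (contDiffAt_snd.prodMk hS).exists_forall_mem_closedBall_exists_eq_forall_mem_Ioo_hasDerivAt₀ t₀
  have ht₀ : t₀ ∈ Ioo (t₀ - ε) (t₀ + ε) := by constructor <;> linarith
  have hyc : ContinuousAt y t₀ := (hy t₀ ht₀).continuousAt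
  have hev : ∀ᶠ t in 𝓝 t₀, y t ∈ N ∧ (∀ a, EulerLagrangeAt e (y t) a ↔ a = S (y t)) ∧
      ContDiffAt ℝ 1 S (y t) :=
    hyc.eventually (by
      rw [hy0]
      exact (eventually_mem_set.2 hN).and (hEL.and (hS.eventually (by simp))))
  obtain ⟨δ, hδ, hball⟩ := Metric.eventually_nhds_iff_ball.1 hev
  rw [Real.ball_eq_Ioo] at hball
  set η := min ε δ
  have hη : 0 < η := lt_min hε hδ
  have hsub1 : Ioo (t₀ - η) (t₀ + η) ⊆ Ioo (t₀ - ε) (t₀ + ε) :=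
    Ioo_subset_Ioo (by linarith [min_le_left ε δ]) (by linarith [min_le_left ε δ])
  have hsub2 : Ioo (t₀ - η) (t₀ + η) ⊆ Ioo (t₀ - δ) (t₀ + δ) :=
    Ioo_subset_Ioo (by linarith [min_le_right ε δ]) (by linarith [min_le_right ε δ])
  have hd1 : ∀ t ∈ Ioo (t₀ - η) (t₀ + η), HasDerivAt (fun r => (y r).1) (y t).2 t := fun t ht =>
    (hasFDerivAt_fst (𝕜 := ℝ) (p := y t)).comp_hasDerivAt t (hy t (hsub1 ht))
  have hd2 : ∀ t ∈ Ioo (t₀ - η) (t₀ + η), HasDerivAt (fun r => (y r).2) (S (y t)) t := fun t ht =>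
    (hasFDerivAt_snd (𝕜 := ℝ) (p := y t)).comp_hasDerivAt t (hy t (hsub1 ht))
  have hdd : ∀ t ∈ Ioo (t₀ - η) (t₀ + η), deriv (fun r => (y r).1) =ᶠ[𝓝 t] fun r => (y r).2 :=
    fun t ht => by
      filter_upwards [isOpen_Ioo.mem_nhds ht] with r hr using (hd1 r hr).deriv
  have hdd2 : ∀ t ∈ Ioo (t₀ - η) (t₀ + η), deriv (deriv fun r => (y r).1) t = S (y t) :=
    fun t ht => by rw [(hdd t ht).deriv_eq, (hd2 t ht).deriv]
  have ht₀' : t₀ ∈ Ioo (t₀ - η) (t₀ + η) := by constructor <;> linarith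
  refine ⟨η, hη, fun r => (y r).1, ?_, by simp [hy0], ?_, fun t ht => ?_⟩
  -- Bootstrapping: `S` is continuous along the solution, so the velocity is `C¹` and the position
  -- is `C²`.
  · rw [show (2 : WithTop ℕ∞) = 1 + 1 by norm_num, contDiffOn_succ_iff_deriv_of_isOpen isOpen_Ioo]
    refine ⟨fun t ht => (hd1 t ht).differentiableAt.differentiableWithinAt, by simp, ?_⟩
    have h1 : ContDiffOn ℝ 1 (fun r => (y r).2) (Ioo (t₀ - η) (t₀ + η)) := by
      rw [show (1 : WithTop ℕ∞) = 0 + 1 by norm_num,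
        contDiffOn_succ_iff_deriv_of_isOpen isOpen_Ioo]
      refine ⟨fun t ht => (hd2 t ht).differentiableAt.differentiableWithinAt, by simp, ?_⟩
      rw [contDiffOn_zero]
      have h2 : ContinuousOn (fun t => S (y t)) (Ioo (t₀ - η) (t₀ + η)) := fun t ht =>
        ((hball t (hsub2 ht)).2.2.continuousAt.comp
          (hy t (hsub1 ht)).continuousAt).continuousWithinAt
      exact h2.congr fun t ht => (hd2 t ht).deriv
    exact h1.congr fun t ht => (hd1 t ht).deriv
  · rw [(hd1 t₀ ht₀').deriv, hy0]
  · have h3 := hball t (hsub2 ht)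
    rw [hdd2 t ht, (hd1 t ht).deriv]
    exact ⟨h3.1, (h3.2.1 _).2 rfl⟩

/-- Both curves, lifted to the phase space, solve the same first-order system, whose right-hand side
is `C¹` and therefore locally Lipschitz. -/
lemma EulerLagrangeAt.eventuallyEq {e : E × E → ℝ} {x₁ x₂ : ℝ → E} {t₀ : ℝ}
    (he : ContDiffAt ℝ ∞ e (x₁ t₀, deriv x₁ t₀))
    (hpos : ∀ w : E, w ≠ 0 →
      0 < fderiv ℝ (fderiv ℝ e) (x₁ t₀, deriv x₁ t₀) (0, w) (0, w))
    (h₁ : ContDiffAt ℝ 2 x₁ t₀) (h₂ : ContDiffAt ℝ 2 x₂ t₀)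
    (hEL₁ : ∀ᶠ t in 𝓝 t₀, EulerLagrangeAt e (x₁ t, deriv x₁ t) (deriv (deriv x₁) t))
    (hEL₂ : ∀ᶠ t in 𝓝 t₀, EulerLagrangeAt e (x₂ t, deriv x₂ t) (deriv (deriv x₂) t))
    (hx : x₁ t₀ = x₂ t₀) (hx' : deriv x₁ t₀ = deriv x₂ t₀) : x₁ =ᶠ[𝓝 t₀] x₂ := by
  obtain ⟨S, hS, hEL⟩ := exists_spray he hpos
  obtain ⟨K, s, hs, hK⟩ := (contDiffAt_snd.prodMk hS :
    ContDiffAt ℝ 1 (fun q : E × E => (q.2, S q)) _).exists_lipschitzOnWith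
  have main : ∀ x : ℝ → E, ContDiffAt ℝ 2 x t₀ →
      (∀ᶠ t in 𝓝 t₀, EulerLagrangeAt e (x t, deriv x t) (deriv (deriv x) t)) →
      (x t₀, deriv x t₀) = (x₁ t₀, deriv x₁ t₀) →
      ∀ᶠ t in 𝓝 t₀, HasDerivAt (fun r => (x r, deriv x r))
        (deriv x t, S (x t, deriv x t)) t ∧ (x t, deriv x t) ∈ s := by
    intro x hx hELx hx0
    have hx2 : ∀ᶠ t in 𝓝 t₀, ContDiffAt ℝ 2 x t := hx.eventually (by simp)
    have hder : ∀ t, ContDiffAt ℝ 2 x t → ContDiffAt ℝ 1 (deriv x) t := fun t ht => by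
      have := ht.fderiv_right (m := 1) (by norm_num)
      exact this.clm_apply contDiffAt_const
    have hcont : ContinuousAt (fun r => (x r, deriv x r)) t₀ :=
      hx.continuousAt.prodMk (hder t₀ hx).continuousAt
    have h3 := hcont.eventually (p := fun q => (∀ a, EulerLagrangeAt e q a ↔ a = S q) ∧ q ∈ s) (by
      simp only [hx0]; exact hEL.and hs)
    filter_upwards [hx2, hELx, h3] with t ht1 ht2 ht3
    refine ⟨?_, ht3.2⟩
    rw [← (ht3.1 _).1 ht2]
    exact (ht1.differentiableAt (by norm_num)).hasDerivAt.prodMk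
      ((hder t ht1).differentiableAt (by norm_num)).hasDerivAt
  have := ODE_solution_unique_of_eventually (v := fun _ q => (q.2, S q)) (s := fun _ => s)
    (Eventually.of_forall fun _ => hK) (main x₁ h₁ hEL₁ rfl)
    (main x₂ h₂ hEL₂ (by rw [hx, hx'])) (by simp [hx, hx'])
  filter_upwards [this] with t ht
  exact congrArg Prod.fst ht

end Spray

/-! ### The energy in a chart, and geodesics as Euler–Lagrange curves. -/

lemma hasDerivAt_vertical_line {E F : Type*} [NormedAddCommGroup E] [NormedSpace ℝ E]
    [NormedAddCommGroup F] [NormedSpace ℝ F] {f : E × E → F} {z v : E}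
    (hf : DifferentiableAt ℝ f (z, v)) (w : E) :
    HasDerivAt (fun b : ℝ => f (z, v + b • w)) (fderiv ℝ f (z, v) (0, w)) 0 := by
  have hline : HasDerivAt (fun b : ℝ => (z, v + b • w)) ((0 : E), w) 0 := by
    have := (hasDerivAt_const (0 : ℝ) z).prodMk
      (((hasDerivAt_id (0 : ℝ)).smul_const w).const_add v)
    simpa using this
  exact HasFDerivAt.comp_hasDerivAt_of_eq 0 hf.hasFDerivAt hline (by simp)

lemma deriv_deriv_vertical_line {E : Type*} [NormedAddCommGroup E] [NormedSpace ℝ E]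
    {e : E × E → ℝ} {z v : E} (he : ContDiffAt ℝ ∞ e (z, v)) (u w : E) :
    deriv (fun a : ℝ => deriv (fun b : ℝ => e (z, v + a • u + b • w)) 0) 0 =
      fderiv ℝ (fderiv ℝ e) (z, v) (0, u) (0, w) := by
  have hl : Tendsto (fun a : ℝ => (z, v + a • u)) (𝓝 0) (𝓝 (z, v)) := by
    have : Continuous (fun a : ℝ => (z, v + a • u)) := by fun_prop
    simpa using this.tendsto 0
  have h1 : (fun a : ℝ => deriv (fun b : ℝ => e (z, v + a • u + b • w)) 0) =ᶠ[𝓝 0]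
      fun a => fderiv ℝ e (z, v + a • u) (0, w) := by
    filter_upwards [hl.eventually (eventually_differentiableAt he)] with a ha
    exact (hasDerivAt_vertical_line ha w).deriv
  rw [h1.deriv_eq]
  have h3 := hasDerivAt_vertical_line (hasFDerivAt_fderiv he).differentiableAt u
  have h4 := h3.clm_apply (hasDerivAt_const (0 : ℝ) ((0 : E), w))
  rw [h4.deriv, map_zero, add_zero]

section Chart

variable {E : Type*} [NormedAddCommGroup E] [NormedSpace ℝ E]
  {M : Type*} [TopologicalSpace M] [ChartedSpace E M]

/-- The square of `F` in the chart at `c`, as a function of position and velocity. -/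
noncomputable def chartEnergy (F : ∀ x : M, TangentSpace 𝓘(ℝ, E) x → ℝ) (c : M) (q : E × E) : ℝ :=
  F ((extChartAt 𝓘(ℝ, E) c).symm q.1) (chartVector c q.1 q.2) ^ 2

/-- All tangent spaces have the same underlying space `E`; this transports the value of `F` between
base points that are equal but not definitionally so. -/
lemma apply_congr_base (F : ∀ x : M, TangentSpace 𝓘(ℝ, E) x → ℝ) {x y : M} (h : x = y)
    {v : TangentSpace 𝓘(ℝ, E) x} {w : TangentSpace 𝓘(ℝ, E) y} (hvw : (v : E) = (w : E)) :
    F x v = F y w := by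
  subst h; exact congrArg (F x) hvw

variable [IsManifold 𝓘(ℝ, E) ∞ M]

lemma contMDiffOn_chartVector (c : M) :
    ContMDiffOn 𝓘(ℝ, E × E) 𝓘(ℝ, E).tangent ∞
      (fun q : E × E => (⟨(extChartAt 𝓘(ℝ, E) c).symm q.1, chartVector c q.1 q.2⟩ :
        TangentBundle 𝓘(ℝ, E) M)) {q | q.1 ∈ (extChartAt 𝓘(ℝ, E) c).target} := by
  have h1 := (contMDiffOn_extChartAt_symm (I := 𝓘(ℝ, E)) (n := ∞) c).contMDiffOn_tangentMapWithin
    (m := ∞) (by simp) (isOpen_extChartAt_target c).uniqueMDiffOn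
  have h2 : ContMDiff 𝓘(ℝ, E × E) 𝓘(ℝ, E).tangent ∞
      (fun q : E × E => (⟨q.1, q.2⟩ : TangentBundle 𝓘(ℝ, E) E)) := by
    have := contMDiff_tangentBundleModelSpaceHomeomorph_symm (I := 𝓘(ℝ, E)) (n := ∞)
    rw [modelWithCornersSelf_prod]
    exact this
  refine (h1.comp h2.contMDiffOn (fun q hq => hq)).congr fun q hq => ?_
  simp only [Function.comp, tangentMapWithin, chartVector]
  rw [mfderivWithin_of_isOpen (isOpen_extChartAt_target c) hq]

lemma chartVector_injective {c : M} {z : E} (hz : z ∈ (extChartAt 𝓘(ℝ, E) c).target) {v : E}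
    (hv : (chartVector c z v : E) = 0) : v = 0 := by
  have h := isInvertible_mfderivWithin_extChartAt_symm (I := 𝓘(ℝ, E)) hz
  simp only [modelWithCornersSelf_coe, range_id, mfderivWithin_univ] at h
  exact h.injective (hv.trans (map_zero _).symm)

lemma IsFinslerMetric.contDiffAt_chartEnergy {F : ∀ x : M, TangentSpace 𝓘(ℝ, E) x → ℝ}
    (hF : IsFinslerMetric F) {c : M} {q : E × E} (hq : q.1 ∈ (extChartAt 𝓘(ℝ, E) c).target)
    (hq2 : q.2 ≠ 0) : ContDiffAt ℝ ∞ (chartEnergy F c) q := by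
  have hU : IsOpen {q : E × E | q.1 ∈ (extChartAt 𝓘(ℝ, E) c).target ∧ q.2 ≠ 0} :=
    ((isOpen_extChartAt_target c).preimage continuous_fst).inter
      (isOpen_compl_singleton.preimage continuous_snd)
  have h1 := hF.smooth.comp ((contMDiffOn_chartVector c).mono
    fun (q : E × E) (hq : q.1 ∈ (extChartAt 𝓘(ℝ, E) c).target ∧ q.2 ≠ 0) => hq.1)
    (fun q hq => fun h => hq.2 (chartVector_injective hq.1 h))
  have h2 := (h1.contMDiffAt (hU.mem_nhds ⟨hq, hq2⟩)).contDiffAt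
  exact h2.pow 2

lemma IsFinslerMetric.chartEnergy_smul {F : ∀ x : M, TangentSpace 𝓘(ℝ, E) x → ℝ}
    (hF : IsFinslerMetric F) (c : M) (q : E × E) (r : ℝ) (hr : 0 < r) :
    chartEnergy F c (q.1, r • q.2) = r ^ 2 * chartEnergy F c q := by
  have h : chartVector c q.1 (r • q.2) = r • chartVector c q.1 q.2 := map_smul _ _ _
  simp only [chartEnergy]
  rw [h, hF.homogeneous _ _ _ hr, mul_pow]

/-- `chartVector` is linear in the components, so affine lines in the tangent space are affine lines
in the velocity variable of the energy. -/
lemma IsFinslerMetric.chartTensor_eq {F : ∀ x : M, TangentSpace 𝓘(ℝ, E) x → ℝ}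
    (hF : IsFinslerMetric F) {c : M} {z v : E} (hz : z ∈ (extChartAt 𝓘(ℝ, E) c).target)
    (hv : v ≠ 0) (u w : E) :
    chartTensor F c z v u w =
      (1 / 2) * fderiv ℝ (fderiv ℝ (chartEnergy F c)) (z, v) (0, u) (0, w) := by
  rw [← deriv_deriv_vertical_line (hF.contDiffAt_chartEnergy (c := c) (q := (z, v)) hz hv) u w]
  have hlin : ∀ a b : ℝ, (chartVector c z (v + a • u + b • w) : E) =
      (chartVector c z v : E) + a • (chartVector c z u : E) + b • (chartVector c z w : E) := by
    intro a b
    let T : E →L[ℝ] E := mfderiv 𝓘(ℝ, E) 𝓘(ℝ, E) (extChartAt 𝓘(ℝ, E) c).symm z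
    have h : T (v + a • u + b • w) = T v + a • T u + b • T w := by
      rw [T.map_add, T.map_add, T.map_smul, T.map_smul]
    exact h
  have h2 : (fun a : ℝ => fun b : ℝ => F ((extChartAt 𝓘(ℝ, E) c).symm z)
      (chartVector c z v + a • chartVector c z u + b • chartVector c z w) ^ 2) =
      fun a b => chartEnergy F c (z, v + a • u + b • w) := by
    funext a b
    exact congrArg (fun y : E => F ((extChartAt 𝓘(ℝ, E) c).symm z) y ^ 2) (hlin a b).symm
  exact congrArg (fun f : ℝ → ℝ → ℝ => (1 / 2) * deriv (fun a => deriv (f a) 0) 0) h2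

lemma IsFinslerMetric.chartEnergy_convex {F : ∀ x : M, TangentSpace 𝓘(ℝ, E) x → ℝ}
    (hF : IsFinslerMetric F) {c : M} {q : E × E} (hz : q.1 ∈ (extChartAt 𝓘(ℝ, E) c).target)
    (hv : q.2 ≠ 0) (w : E) (hw : w ≠ 0) :
    0 < fderiv ℝ (fderiv ℝ (chartEnergy F c)) q (0, w) (0, w) := by
  have h1 := hF.chartTensor_eq hz hv w w
  have h2 : 0 < chartTensor F c q.1 q.2 w w :=
    hF.strongly_convex _ _ _ (fun h => hv (chartVector_injective hz h))
      (fun h => hw (chartVector_injective hz h))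
  rw [h1] at h2
  simpa using h2

/-- The geodesic equation in a chart is the Euler–Lagrange equation of the energy. -/
lemma IsFinslerMetric.geodesic_equation_iff {F : ∀ x : M, TangentSpace 𝓘(ℝ, E) x → ℝ}
    (hF : IsFinslerMetric F) {c : M} {z v a : E} (hz : z ∈ (extChartAt 𝓘(ℝ, E) c).target)
    (hv : v ≠ 0) :
    (∀ w, chartTensor F c z v a w + fderiv ℝ (fun z => chartTensor F c z v v w) z v
      - (1 / 2) * fderiv ℝ (fun z => chartTensor F c z v v v) z w = 0) ↔
    EulerLagrangeAt (chartEnergy F c) (z, v) a := by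
  set e := chartEnergy F c with he
  have hsm : ∀ z ∈ (extChartAt 𝓘(ℝ, E) c).target, ContDiffAt ℝ ∞ e (z, v) := fun z hz =>
    hF.contDiffAt_chartEnergy hz hv
  -- By Euler's identities, contracting the fundamental tensor once with the reference vector `v`
  -- gives half the vertical derivative of the energy, and contracting it twice gives the energy.
  -- The geodesic expression thereby becomes half the Euler–Lagrange expression.
  have h1 : ∀ w, ∀ z ∈ (extChartAt 𝓘(ℝ, E) c).target,
      chartTensor F c z v v w = (1 / 2) * fderiv ℝ e (z, v) (0, w) := fun w z hz => by
    rw [hF.chartTensor_eq hz hv, fderiv_fderiv_vertical_self (p := (z, v)) (hsm z hz)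
      (Eventually.of_forall fun q r hr => hF.chartEnergy_smul c q r hr)]
  have h2 : ∀ z ∈ (extChartAt 𝓘(ℝ, E) c).target, chartTensor F c z v v v = e (z, v) :=
    fun z hz => by
      rw [h1 v z hz, fderiv_vertical_self (p := (z, v)) ((hsm z hz).differentiableAt (by simp))
        fun r hr => hF.chartEnergy_smul c (z, v) r hr]
      ring
  have hmem := (isOpen_extChartAt_target (I := 𝓘(ℝ, E)) c).mem_nhds hz
  have hincl : HasFDerivAt (fun z : E => (z, v)) (ContinuousLinearMap.inl ℝ E E) z :=
    hasFDerivAt_prodMk_left z v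
  have h3 : ∀ w, fderiv ℝ (fun z => chartTensor F c z v v v) z w = fderiv ℝ e (z, v) (w, 0) := by
    intro w
    have hev : (fun z => chartTensor F c z v v v) =ᶠ[𝓝 z] fun z => e (z, v) := by
      filter_upwards [hmem] with y hy using h2 y hy
    have hd : HasFDerivAt (e ∘ fun z => (z, v)) _ z :=
      ((hsm z hz).differentiableAt (by simp)).hasFDerivAt.comp z hincl
    change HasFDerivAt (fun z => e (z, v)) _ z at hd
    rw [hev.fderiv_eq, hd.fderiv]
    simp
  have h4 : ∀ w, fderiv ℝ (fun z => chartTensor F c z v v w) z v =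
      (1 / 2) * fderiv ℝ (fderiv ℝ e) (z, v) (v, 0) (0, w) := by
    intro w
    have hev : (fun z => chartTensor F c z v v w) =ᶠ[𝓝 z]
        fun z => (1 / 2) * fderiv ℝ e (z, v) (0, w) := by
      filter_upwards [hmem] with y hy using h1 w y hy
    have hd0 : HasFDerivAt (fun z => fderiv ℝ e (z, v)) _ z :=
      (hasFDerivAt_fderiv (hsm z hz)).comp z hincl
    have hd := (hd0.clm_apply (hasFDerivAt_const ((0 : E), w) z)).const_mul (1 / 2 : ℝ)
    rw [hev.fderiv_eq, hd.fderiv]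
    simp
  refine forall_congr' fun w => ?_
  have h5 : fderiv ℝ (fderiv ℝ e) (z, v) (v, a) (0, w)
      = fderiv ℝ (fderiv ℝ e) (z, v) (v, 0) (0, w) + fderiv ℝ (fderiv ℝ e) (z, v) (0, a) (0, w) := by
    rw [← add_apply, ← map_add]; simp
  rw [hF.chartTensor_eq hz hv, h3, h4]
  simp only [← he]
  rw [h5]
  constructor <;> intro h <;> linarith

/-- The geodesic equation of `F` in the chart at `c`, for the curve `γ` at the time `t`. -/
def GeodesicEquationAt (F : ∀ x : M, TangentSpace 𝓘(ℝ, E) x → ℝ) (c : M) (γ : ℝ → M) (t : ℝ) :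
    Prop :=
  EulerLagrangeAt (chartEnergy F c)
    (extChartAt 𝓘(ℝ, E) c (γ t), deriv (fun r => extChartAt 𝓘(ℝ, E) c (γ r)) t)
    (deriv (deriv fun r => extChartAt 𝓘(ℝ, E) c (γ r)) t)

lemma contDiffAt_extChartAt_comp {γ : ℝ → M} {t : ℝ} {n : WithTop ℕ∞} (hn : n ≤ ∞)
    (hγ : ContMDiffAt 𝓘(ℝ, ℝ) 𝓘(ℝ, E) n γ t) {c : M}
    (hc : γ t ∈ (extChartAt 𝓘(ℝ, E) c).source) :
    ContDiffAt ℝ n (fun r => extChartAt 𝓘(ℝ, E) c (γ r)) t := by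
  have h1 : ContMDiffAt 𝓘(ℝ, E) 𝓘(ℝ, E) n (extChartAt 𝓘(ℝ, E) c) (γ t) :=
    (contMDiffAt_extChartAt' (by simpa using hc) (n := ∞)).of_le hn
  exact (h1.comp t hγ).contDiffAt

lemma mfderiv_curve_eq {γ : ℝ → M} {t : ℝ} (hγ : MDifferentiableAt 𝓘(ℝ, ℝ) 𝓘(ℝ, E) γ t) {c : M}
    (hc : γ t ∈ (extChartAt 𝓘(ℝ, E) c).source) :
    (mfderiv 𝓘(ℝ, ℝ) 𝓘(ℝ, E) γ t (1 : ℝ) : E) =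
      chartVector c (extChartAt 𝓘(ℝ, E) c (γ t))
        (deriv (fun r => extChartAt 𝓘(ℝ, E) c (γ r)) t) := by
  have hz := (extChartAt 𝓘(ℝ, E) c).map_source hc
  have h1 : MDifferentiableAt 𝓘(ℝ, E) 𝓘(ℝ, E) (extChartAt 𝓘(ℝ, E) c) (γ t) :=
    mdifferentiableAt_extChartAt (by simpa using hc)
  have h2 : MDifferentiableAt 𝓘(ℝ, E) 𝓘(ℝ, E) (extChartAt 𝓘(ℝ, E) c).symm
      (extChartAt 𝓘(ℝ, E) c (γ t)) :=
    ((contMDiffOn_extChartAt_symm (I := 𝓘(ℝ, E)) (n := ∞) c).contMDiffAt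
      ((isOpen_extChartAt_target c).mem_nhds hz)).mdifferentiableAt (by simp)
  have hx : HasMFDerivAt 𝓘(ℝ, ℝ) 𝓘(ℝ, E) (fun r => extChartAt 𝓘(ℝ, E) c (γ r)) t
      (fderiv ℝ (fun r => extChartAt 𝓘(ℝ, E) c (γ r)) t) :=
    (mdifferentiableAt_iff_differentiableAt.1 (h1.comp t hγ)).hasFDerivAt.hasMFDerivAt
  have hev : γ =ᶠ[𝓝 t] (extChartAt 𝓘(ℝ, E) c).symm ∘ fun r => extChartAt 𝓘(ℝ, E) c (γ r) := by
    filter_upwards [hγ.continuousAt.preimage_mem_nhds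
      ((isOpen_extChartAt_source c).mem_nhds hc)] with r hr
    exact ((extChartAt 𝓘(ℝ, E) c).left_inv hr).symm
  have h3 := (h2.hasMFDerivAt.comp t hx).congr_of_eventuallyEq hev
  have h4 := congrArg (fun T : ℝ →L[ℝ] E => T 1) h3.mfderiv
  exact h4

lemma deriv_extChartAt_ne_zero {γ : ℝ → M} {t : ℝ}
    (hγ : MDifferentiableAt 𝓘(ℝ, ℝ) 𝓘(ℝ, E) γ t) (hreg : mfderiv 𝓘(ℝ, ℝ) 𝓘(ℝ, E) γ t ≠ 0) {c : M}
    (hc : γ t ∈ (extChartAt 𝓘(ℝ, E) c).source) :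
    deriv (fun r => extChartAt 𝓘(ℝ, E) c (γ r)) t ≠ 0 := by
  intro h
  apply hreg
  have h1 := mfderiv_curve_eq hγ hc
  rw [h] at h1
  have h2 : (chartVector c (extChartAt 𝓘(ℝ, E) c (γ t)) 0 : E) = 0 := map_zero _
  ext
  exact h1.trans h2

lemma mfderiv_curve_ne_zero {γ : ℝ → M} {t : ℝ}
    (hγ : MDifferentiableAt 𝓘(ℝ, ℝ) 𝓘(ℝ, E) γ t) {c : M}
    (hc : γ t ∈ (extChartAt 𝓘(ℝ, E) c).source)
    (hd : deriv (fun r => extChartAt 𝓘(ℝ, E) c (γ r)) t ≠ 0) :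
    mfderiv 𝓘(ℝ, ℝ) 𝓘(ℝ, E) γ t ≠ 0 := by
  intro h
  have h1 := mfderiv_curve_eq hγ hc
  rw [h] at h1
  exact hd (chartVector_injective ((extChartAt 𝓘(ℝ, E) c).map_source hc) h1.symm)

/-- Geodesics are the regular curves that solve the Euler–Lagrange equation in every chart. -/
lemma IsFinslerMetric.isGeodesicOn_iff {F : ∀ x : M, TangentSpace 𝓘(ℝ, E) x → ℝ}
    (hF : IsFinslerMetric F) {γ : ℝ → M} {J : Set ℝ} (hJ : IsOpen J) :
    IsGeodesicOn F γ J ↔ ContMDiffOn 𝓘(ℝ, ℝ) 𝓘(ℝ, E) 2 γ J ∧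
      (∀ t ∈ J, mfderiv 𝓘(ℝ, ℝ) 𝓘(ℝ, E) γ t ≠ 0) ∧
      ∀ c : M, ∀ t ∈ J, γ t ∈ (extChartAt 𝓘(ℝ, E) c).source → GeodesicEquationAt F c γ t := by
  have main : ContMDiffOn 𝓘(ℝ, ℝ) 𝓘(ℝ, E) 2 γ J →
      (∀ t ∈ J, mfderiv 𝓘(ℝ, ℝ) 𝓘(ℝ, E) γ t ≠ 0) → ∀ c : M, ∀ t ∈ J,
      γ t ∈ (extChartAt 𝓘(ℝ, E) c).source → deriv (fun r => extChartAt 𝓘(ℝ, E) c (γ r)) t ≠ 0 :=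
    fun h1 h2 c t ht hc => deriv_extChartAt_ne_zero
      ((h1.contMDiffAt (hJ.mem_nhds ht)).mdifferentiableAt (by norm_num)) (h2 t ht) hc
  constructor
  · rintro ⟨h1, h2, h3⟩
    exact ⟨h1, h2, fun c t ht hc => (hF.geodesic_equation_iff
      ((extChartAt 𝓘(ℝ, E) c).map_source hc) (main h1 h2 c t ht hc)).1 (h3 c t ht hc)⟩
  · rintro ⟨h1, h2, h3⟩
    exact ⟨h1, h2, fun c t ht hc => (hF.geodesic_equation_iff
      ((extChartAt 𝓘(ℝ, E) c).map_source hc) (main h1 h2 c t ht hc)).2 (h3 c t ht hc)⟩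

end Chart

/-! ### Isometries, and the geodesics through a given vector. -/

lemma deriv_comp_phaseMap {E E' : Type*} [NormedAddCommGroup E] [NormedSpace ℝ E]
    [NormedAddCommGroup E'] [NormedSpace ℝ E'] {ψ : E → E'} {x : ℝ → E} {y : ℝ → E'} {t : ℝ}
    (hψ : ContDiffAt ℝ ∞ ψ (x t)) (hx : ContDiffAt ℝ 2 x t) (hy : y =ᶠ[𝓝 t] fun r => ψ (x r)) :
    (y t, deriv y t) = phaseMap ψ (x t, deriv x t) ∧
      deriv (deriv y) t = fderiv ℝ (fderiv ℝ ψ) (x t) (deriv x t) (deriv x t) +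
        fderiv ℝ ψ (x t) (deriv (deriv x) t) := by
  have hx1 : ∀ᶠ r in 𝓝 t, DifferentiableAt ℝ x r := by
    filter_upwards [hx.eventually (by simp)] with r hr using hr.differentiableAt (by norm_num)
  have hdx : DifferentiableAt ℝ (deriv x) t := by
    have := hx.fderiv_right (m := 1) (by norm_num)
    exact (this.clm_apply contDiffAt_const).differentiableAt (by norm_num)
  have h1 : deriv y =ᶠ[𝓝 t] fun r => fderiv ℝ ψ (x r) (deriv x r) := by
    filter_upwards [hy.eventuallyEq_nhds, hx1,
      hx.continuousAt.eventually (eventually_differentiableAt hψ)] with r hr hr1 hr2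
    rw [hr.deriv_eq]
    exact (hr2.hasFDerivAt.comp_hasDerivAt r hr1.hasDerivAt).deriv
  refine ⟨Prod.ext hy.self_of_nhds h1.self_of_nhds, ?_⟩
  rw [h1.deriv_eq]
  have h2 : HasDerivAt (fun r => fderiv ℝ ψ (x r)) _ t :=
    (hasFDerivAt_fderiv hψ).comp_hasDerivAt t hx1.self_of_nhds.hasDerivAt
  exact (h2.clm_apply hdx.hasDerivAt).deriv

section Isometry

variable {E : Type*} [NormedAddCommGroup E] [NormedSpace ℝ E]
  {M : Type*} [TopologicalSpace M] [ChartedSpace E M]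

/-- A smooth self-map of `M`, read in the charts at `c` and `c'`. -/
noncomputable def inCharts (f : M → M) (c c' : M) (z : E) : E :=
  extChartAt 𝓘(ℝ, E) c' (f ((extChartAt 𝓘(ℝ, E) c).symm z))

/-- A smooth map that preserves `F`. -/
structure IsMetricPreserving (F : ∀ x : M, TangentSpace 𝓘(ℝ, E) x → ℝ) (f : M → M) : Prop where
  smooth : ContMDiff 𝓘(ℝ, E) 𝓘(ℝ, E) ∞ f
  preserves : ∀ (x : M) (v : TangentSpace 𝓘(ℝ, E) x), F (f x) (mfderiv 𝓘(ℝ, E) 𝓘(ℝ, E) f x v) = F x v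

lemma isMetricPreserving_id (F : ∀ x : M, TangentSpace 𝓘(ℝ, E) x → ℝ) :
    IsMetricPreserving F id :=
  ⟨contMDiff_id, fun x v => by rw [mfderiv_id]; rfl⟩

variable [IsManifold 𝓘(ℝ, E) ∞ M]

lemma contDiffAt_inCharts {f : M → M} (hf : ContMDiff 𝓘(ℝ, E) 𝓘(ℝ, E) ∞ f) {c c' : M} {z : E}
    (hz : z ∈ (extChartAt 𝓘(ℝ, E) c).target)
    (hz' : f ((extChartAt 𝓘(ℝ, E) c).symm z) ∈ (extChartAt 𝓘(ℝ, E) c').source) :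
    ContDiffAt ℝ ∞ (inCharts f c c') z := by
  have h1 : ContMDiffAt 𝓘(ℝ, E) 𝓘(ℝ, E) ∞ (extChartAt 𝓘(ℝ, E) c').toFun
    (f ((extChartAt 𝓘(ℝ, E) c).symm z)) := contMDiffAt_extChartAt' (by simpa using hz')
  have h2 : ContMDiffAt 𝓘(ℝ, E) 𝓘(ℝ, E) ∞ (extChartAt 𝓘(ℝ, E) c).symm z :=
    (contMDiffOn_extChartAt_symm (I := 𝓘(ℝ, E)) (n := ∞) c).contMDiffAt
      ((isOpen_extChartAt_target c).mem_nhds hz)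
  exact (h1.comp z ((hf _).comp z h2)).contDiffAt

/-- The identity `f ∘ chart⁻¹ = chart'⁻¹ ∘ inCharts f` holds near `z`. Differentiating it identifies
the image of a coordinate vector under `f`. With `f = id` this is the change of charts. -/
lemma IsMetricPreserving.chartEnergy_eq {F : ∀ x : M, TangentSpace 𝓘(ℝ, E) x → ℝ} {f : M → M}
    (hf : IsMetricPreserving F f) {c c' : M} {z : E} (hz : z ∈ (extChartAt 𝓘(ℝ, E) c).target)
    (hz' : f ((extChartAt 𝓘(ℝ, E) c).symm z) ∈ (extChartAt 𝓘(ℝ, E) c').source) (v : E) :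
    chartEnergy F c (z, v) = chartEnergy F c' (phaseMap (inCharts f c c') (z, v)) := by
  have h2 : ∀ {c : M} {z : E}, z ∈ (extChartAt 𝓘(ℝ, E) c).target →
      MDifferentiableAt 𝓘(ℝ, E) 𝓘(ℝ, E) (extChartAt 𝓘(ℝ, E) c).symm z := fun {c z} hz =>
    ((contMDiffOn_extChartAt_symm (I := 𝓘(ℝ, E)) (n := ∞) c).contMDiffAt
      ((isOpen_extChartAt_target c).mem_nhds hz)).mdifferentiableAt (by simp)
  have hf' : MDifferentiableAt 𝓘(ℝ, E) 𝓘(ℝ, E) f ((extChartAt 𝓘(ℝ, E) c).symm z) :=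
    (hf.smooth _).mdifferentiableAt (by simp)
  let D : E →L[ℝ] E := fderiv ℝ (inCharts f c c') z
  have hψ : HasMFDerivAt 𝓘(ℝ, E) 𝓘(ℝ, E) (inCharts f c c') z D :=
    ((contDiffAt_inCharts hf.smooth hz hz').differentiableAt (by simp)).hasFDerivAt.hasMFDerivAt
  have hmaps : inCharts f c c' z ∈ (extChartAt 𝓘(ℝ, E) c').target :=
    (extChartAt 𝓘(ℝ, E) c').map_source hz'
  have hA := hf'.hasMFDerivAt.comp z (h2 hz).hasMFDerivAt
  have hB := (h2 hmaps).hasMFDerivAt.comp z hψ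
  have hinv : (extChartAt 𝓘(ℝ, E) c').symm (inCharts f c c' z) =
      f ((extChartAt 𝓘(ℝ, E) c).symm z) := (extChartAt 𝓘(ℝ, E) c').left_inv hz'
  have hev : f ∘ (extChartAt 𝓘(ℝ, E) c).symm =ᶠ[𝓝 z]
      (extChartAt 𝓘(ℝ, E) c').symm ∘ inCharts f c c' := by
    have hc : ContinuousAt (f ∘ (extChartAt 𝓘(ℝ, E) c).symm) z := hA.continuousAt
    filter_upwards [hc.preimage_mem_nhds ((isOpen_extChartAt_source c').mem_nhds hz')] with y hy
    exact ((extChartAt 𝓘(ℝ, E) c').left_inv hy).symm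
  have hC := hB.congr_of_eventuallyEq hev
  have hD : (mfderiv 𝓘(ℝ, E) 𝓘(ℝ, E) f ((extChartAt 𝓘(ℝ, E) c).symm z) (chartVector c z v) : E) =
      chartVector c' (inCharts f c c' z) (D v) :=
    congrArg (fun T : E →L[ℝ] E => T v) (hA.mfderiv.symm.trans hC.mfderiv)
  unfold chartEnergy phaseMap
  rw [← hf.preserves]
  congr 1
  exact apply_congr_base F hinv.symm hD

variable {F : ∀ x : M, TangentSpace 𝓘(ℝ, E) x → ℝ} {f : M → M} {γ : ℝ → M} {t : ℝ} {c c' : M}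

lemma phaseMap_inCharts (hf : ContMDiff 𝓘(ℝ, E) 𝓘(ℝ, E) ∞ f)
    (hγ : ContMDiffAt 𝓘(ℝ, ℝ) 𝓘(ℝ, E) 2 γ t)
    (hc : γ t ∈ (extChartAt 𝓘(ℝ, E) c).source) (hc' : f (γ t) ∈ (extChartAt 𝓘(ℝ, E) c').source) :
    let x : ℝ → E := fun r => extChartAt 𝓘(ℝ, E) c (γ r)
    let y : ℝ → E := fun r => extChartAt 𝓘(ℝ, E) c' (f (γ r))
    let ψ := inCharts f c c'
    (y t, deriv y t) = phaseMap ψ (x t, deriv x t) ∧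
      deriv (deriv y) t = fderiv ℝ (fderiv ℝ ψ) (x t) (deriv x t) (deriv x t) +
        fderiv ℝ ψ (x t) (deriv (deriv x) t) := by
  intro x y ψ
  have hz := (extChartAt 𝓘(ℝ, E) c).map_source hc
  have hz' : f ((extChartAt 𝓘(ℝ, E) c).symm (x t)) ∈ (extChartAt 𝓘(ℝ, E) c').source := by
    simpa only [x, (extChartAt 𝓘(ℝ, E) c).left_inv hc] using hc'
  refine deriv_comp_phaseMap (contDiffAt_inCharts hf hz hz')
    (contDiffAt_extChartAt_comp (by norm_cast) hγ hc) ?_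
  filter_upwards [hγ.continuousAt.preimage_mem_nhds
      ((isOpen_extChartAt_source c).mem_nhds hc)] with r hr
  simp only [y, ψ, inCharts, x, (extChartAt 𝓘(ℝ, E) c).left_inv hr]

lemma IsMetricPreserving.chartEnergy_curve (hf : IsMetricPreserving F f)
    (hγ : ContMDiffAt 𝓘(ℝ, ℝ) 𝓘(ℝ, E) 2 γ t)
    (hc : γ t ∈ (extChartAt 𝓘(ℝ, E) c).source) (hc' : f (γ t) ∈ (extChartAt 𝓘(ℝ, E) c').source) :
    chartEnergy F c (extChartAt 𝓘(ℝ, E) c (γ t), deriv (fun r => extChartAt 𝓘(ℝ, E) c (γ r)) t) =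
      chartEnergy F c' (extChartAt 𝓘(ℝ, E) c' (f (γ t)),
        deriv (fun r => extChartAt 𝓘(ℝ, E) c' (f (γ r))) t) := by
  rw [(phaseMap_inCharts hf.smooth hγ hc hc').1]
  refine hf.chartEnergy_eq ((extChartAt 𝓘(ℝ, E) c).map_source hc) ?_ _
  simpa only [(extChartAt 𝓘(ℝ, E) c).left_inv hc] using hc'

/-- The geodesic equation for the image of a curve under an isometry, in any chart, implies that
for the curve itself, in any chart. -/
lemma GeodesicEquationAt.of_isMetricPreserving (hF : IsFinslerMetric F)
    (hf : IsMetricPreserving F f) (hγ : ContMDiffAt 𝓘(ℝ, ℝ) 𝓘(ℝ, E) 2 γ t)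
    (hc : γ t ∈ (extChartAt 𝓘(ℝ, E) c).source) (hc' : f (γ t) ∈ (extChartAt 𝓘(ℝ, E) c').source)
    (hne : mfderiv 𝓘(ℝ, ℝ) 𝓘(ℝ, E) (fun r => f (γ r)) t ≠ 0)
    (h : GeodesicEquationAt F c' (fun r => f (γ r)) t) : GeodesicEquationAt F c γ t := by
  obtain ⟨h1, h2⟩ := phaseMap_inCharts hf.smooth hγ hc hc'
  have hz := (extChartAt 𝓘(ℝ, E) c).map_source hc
  have hz' : f ((extChartAt 𝓘(ℝ, E) c).symm (extChartAt 𝓘(ℝ, E) c (γ t))) ∈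
      (extChartAt 𝓘(ℝ, E) c').source := by
    simpa only [(extChartAt 𝓘(ℝ, E) c).left_inv hc] using hc'
  have hd : MDifferentiableAt 𝓘(ℝ, ℝ) 𝓘(ℝ, E) (fun r => f (γ r)) t :=
    ((hf.smooth _).mdifferentiableAt (by simp)).comp t (hγ.mdifferentiableAt (by norm_num))
  unfold GeodesicEquationAt at h ⊢
  rw [h1, h2] at h
  refine EulerLagrangeAt.of_phaseMap (contDiffAt_inCharts hf.smooth hz hz') ?_ ?_ h
  · rw [← h1]
    exact hF.contDiffAt_chartEnergy ((extChartAt 𝓘(ℝ, E) c').map_source hc')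
      (deriv_extChartAt_ne_zero hd hne hc')
  · have hopen : ∀ᶠ z in 𝓝 (extChartAt 𝓘(ℝ, E) c (γ t)), z ∈ (extChartAt 𝓘(ℝ, E) c).target ∧
        f ((extChartAt 𝓘(ℝ, E) c).symm z) ∈ (extChartAt 𝓘(ℝ, E) c').source :=
      ((isOpen_extChartAt_target c).mem_nhds hz |> eventually_mem_set.2).and
        ((hf.smooth.continuous.continuousAt.comp
          (continuousAt_extChartAt_symm'' hz)).preimage_mem_nhds
          ((isOpen_extChartAt_source c').mem_nhds hz'))
    have hfst : Tendsto Prod.fst (𝓝 (extChartAt 𝓘(ℝ, E) c (γ t),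
        deriv (fun r => extChartAt 𝓘(ℝ, E) c (γ r)) t)) (𝓝 (extChartAt 𝓘(ℝ, E) c (γ t))) :=
      continuous_fst.continuousAt
    filter_upwards [hfst.eventually hopen] with q hq
    exact hf.chartEnergy_eq hq.1 hq.2 q.2

variable [FiniteDimensional ℝ E]

/-- Short geodesics with a prescribed initial velocity. -/
lemma IsFinslerMetric.exists_geodesic (hF : IsFinslerMetric F) (c : M) {q : E × E}
    (hq : q.1 ∈ (extChartAt 𝓘(ℝ, E) c).target) (hq2 : q.2 ≠ 0) (t₀ : ℝ) :
    ∃ ε > 0, ∃ γ : ℝ → M, IsGeodesicOn F γ (Ioo (t₀ - ε) (t₀ + ε)) ∧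
      γ t₀ = (extChartAt 𝓘(ℝ, E) c).symm q.1 ∧
      deriv (fun r => extChartAt 𝓘(ℝ, E) c (γ r)) t₀ = q.2 := by
  have hN : {q : E × E | q.1 ∈ (extChartAt 𝓘(ℝ, E) c).target ∧ q.2 ≠ 0} ∈ 𝓝 q :=
    (((isOpen_extChartAt_target c).preimage continuous_fst).inter
      (isOpen_compl_singleton.preimage continuous_snd)).mem_nhds ⟨hq, hq2⟩
  obtain ⟨ε, hε, x, hx, hx0, hx0', hsol⟩ := EulerLagrangeAt.exists_solution
    (hF.contDiffAt_chartEnergy hq hq2) (hF.chartEnergy_convex hq hq2) hN t₀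
  set J := Ioo (t₀ - ε) (t₀ + ε)
  have ht₀ : t₀ ∈ J := ⟨by linarith, by linarith⟩
  set γ : ℝ → M := fun t => (extChartAt 𝓘(ℝ, E) c).symm (x t)
  have hγ : ContMDiffOn 𝓘(ℝ, ℝ) 𝓘(ℝ, E) 2 γ J :=
    ((contMDiffOn_extChartAt_symm (I := 𝓘(ℝ, E)) (n := ∞) c).of_le (by norm_cast)).comp
      hx.contMDiffOn fun t ht => (hsol t ht).1.1
  have hγat : ∀ t ∈ J, ContMDiffAt 𝓘(ℝ, ℝ) 𝓘(ℝ, E) 2 γ t := fun t ht =>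
    hγ.contMDiffAt (isOpen_Ioo.mem_nhds ht)
  have hγc : ∀ t ∈ J, γ t ∈ (extChartAt 𝓘(ℝ, E) c).source := fun t ht =>
    (extChartAt 𝓘(ℝ, E) c).map_target (hsol t ht).1.1
  have hxγ : ∀ t ∈ J, (fun r => extChartAt 𝓘(ℝ, E) c (γ r)) =ᶠ[𝓝 t] x := fun t ht => by
    filter_upwards [isOpen_Ioo.mem_nhds ht] with r hr
    exact (extChartAt 𝓘(ℝ, E) c).right_inv (hsol r hr).1.1
  have hne : ∀ t ∈ J, mfderiv 𝓘(ℝ, ℝ) 𝓘(ℝ, E) γ t ≠ 0 := fun t ht =>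
    mfderiv_curve_ne_zero ((hγat t ht).mdifferentiableAt (by norm_num)) (hγc t ht)
      (by rw [(hxγ t ht).deriv_eq]; exact (hsol t ht).1.2)
  have heq : ∀ t ∈ J, GeodesicEquationAt F c γ t := fun t ht => by
    unfold GeodesicEquationAt
    rw [(hxγ t ht).deriv.deriv_eq, (hxγ t ht).deriv_eq,
      show extChartAt 𝓘(ℝ, E) c (γ t) = x t from (hxγ t ht).self_of_nhds]
    exact (hsol t ht).2
  refine ⟨ε, hε, γ, (hF.isGeodesicOn_iff isOpen_Ioo).2 ⟨hγ, hne, fun c' t ht hc' => ?_⟩,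
    by simp only [γ, hx0], by rw [(hxγ t₀ ht₀).deriv_eq, hx0']⟩
  -- The curve was constructed in the chart at `c`; covariance under the identity map gives its
  -- equation in every other chart.
  exact GeodesicEquationAt.of_isMetricPreserving hF (isMetricPreserving_id F) (hγat t ht) hc'
    (hγc t ht) (hne t ht) (heq t ht)

/-- Two geodesics with the same velocity at the time `t` agree near `t`. -/
lemma IsFinslerMetric.geodesic_eventuallyEq (hF : IsFinslerMetric F) {γ₁ γ₂ : ℝ → M} {J : Set ℝ}
    (hJ : IsOpen J) (h₁ : IsGeodesicOn F γ₁ J) (h₂ : IsGeodesicOn F γ₂ J) (ht : t ∈ J)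
    (h : γ₁ t = γ₂ t) (hc : γ₁ t ∈ (extChartAt 𝓘(ℝ, E) c).source)
    (h' : deriv (fun r => extChartAt 𝓘(ℝ, E) c (γ₁ r)) t =
      deriv (fun r => extChartAt 𝓘(ℝ, E) c (γ₂ r)) t) : γ₁ =ᶠ[𝓝 t] γ₂ := by
  have hsm : ∀ {γ : ℝ → M}, IsGeodesicOn F γ J → ContMDiffAt 𝓘(ℝ, ℝ) 𝓘(ℝ, E) 2 γ t := fun hγ =>
    hγ.smooth.contMDiffAt (hJ.mem_nhds ht)
  have hsrc : ∀ {γ : ℝ → M}, IsGeodesicOn F γ J → γ t ∈ (extChartAt 𝓘(ℝ, E) c).source →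
      ∀ᶠ r in 𝓝 t, γ r ∈ (extChartAt 𝓘(ℝ, E) c).source := fun hγ hc =>
    (hsm hγ).continuousAt.preimage_mem_nhds ((isOpen_extChartAt_source c).mem_nhds hc)
  have hEL : ∀ {γ : ℝ → M}, IsGeodesicOn F γ J → γ t ∈ (extChartAt 𝓘(ℝ, E) c).source →
      ∀ᶠ r in 𝓝 t, GeodesicEquationAt F c γ r := fun hγ hc => by
    filter_upwards [hsrc hγ hc, hJ.mem_nhds ht] with r hr hrJ
    exact ((hF.isGeodesicOn_iff hJ).1 hγ).2.2 c r hrJ hr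
  have hc₂ : γ₂ t ∈ (extChartAt 𝓘(ℝ, E) c).source := h ▸ hc
  have hz := (extChartAt 𝓘(ℝ, E) c).map_source hc
  have hv := deriv_extChartAt_ne_zero ((hsm h₁).mdifferentiableAt (by norm_num))
    (h₁.regular t ht) hc
  have key := EulerLagrangeAt.eventuallyEq
    (hF.contDiffAt_chartEnergy
      (q := (extChartAt 𝓘(ℝ, E) c (γ₁ t), deriv (fun r => extChartAt 𝓘(ℝ, E) c (γ₁ r)) t)) hz hv)
    (hF.chartEnergy_convex hz hv)
    (contDiffAt_extChartAt_comp (by norm_cast) (hsm h₁) hc)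
    (contDiffAt_extChartAt_comp (by norm_cast) (hsm h₂) hc₂)
    (hEL h₁ hc) (hEL h₂ hc₂) (by rw [h]) h'
  filter_upwards [key, hsrc h₁ hc, hsrc h₂ hc₂] with r hr hr₁ hr₂
  exact (extChartAt 𝓘(ℝ, E) c).injOn hr₁ hr₂ hr

/-- Geodesics on an interval with the same initial velocity agree. -/
lemma IsFinslerMetric.geodesic_eqOn [T2Space M] (hF : IsFinslerMetric F) {γ₁ γ₂ : ℝ → M}
    {J : Set ℝ} (hJ : IsOpen J) (hJ' : J.OrdConnected) (h₁ : IsGeodesicOn F γ₁ J)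
    (h₂ : IsGeodesicOn F γ₂ J) (ht : t ∈ J) (h : γ₁ t = γ₂ t)
    (hc : γ₁ t ∈ (extChartAt 𝓘(ℝ, E) c).source)
    (h' : deriv (fun r => extChartAt 𝓘(ℝ, E) c (γ₁ r)) t =
      deriv (fun r => extChartAt 𝓘(ℝ, E) c (γ₂ r)) t) : EqOn γ₁ γ₂ J := by
  -- Agreement of germs is open by definition. At a limit point in `J`, positions and velocities
  -- agree by continuity, so local uniqueness applies again and `u` is relatively closed.
  set u : Set ℝ := {r | γ₁ =ᶠ[𝓝 r] γ₂}
  have hu : IsOpen u := isOpen_iff_mem_nhds.2 fun r hr => eventually_eventually_nhds.2 hr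
  have hsub : J ⊆ u := by
    refine hJ'.isPreconnected.subset_of_closure_inter_subset hu
      ⟨t, ht, hF.geodesic_eventuallyEq hJ h₁ h₂ ht h hc h'⟩ ?_
    rintro r ⟨hr, hrJ⟩
    have hfr : ∃ᶠ y in 𝓝 r, y ∈ u := mem_closure_iff_frequently.1 hr
    have hsm : ∀ {γ : ℝ → M}, IsGeodesicOn F γ J → ContMDiffAt 𝓘(ℝ, ℝ) 𝓘(ℝ, E) 2 γ r := fun hγ =>
      hγ.smooth.contMDiffAt (hJ.mem_nhds hrJ)
    have hval : γ₁ r = γ₂ r := by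
      by_contra hne
      have hev : ∀ᶠ y in 𝓝 r, γ₁ y ≠ γ₂ y :=
        (hsm h₁).continuousAt.ne_iff_eventually_ne (hsm h₂).continuousAt |>.1 hne
      obtain ⟨y, hy, hy'⟩ := (hfr.and_eventually hev).exists
      exact hy' hy.self_of_nhds
    have hcs : γ₁ r ∈ (extChartAt 𝓘(ℝ, E) (γ₁ r)).source := mem_extChartAt_source _
    have hder : ∀ {γ : ℝ → M}, IsGeodesicOn F γ J → γ r = γ₁ r →
        ContinuousAt (deriv fun y => extChartAt 𝓘(ℝ, E) (γ₁ r) (γ y)) r := fun {γ} hγ he => by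
      have h3 : ContDiffAt ℝ 2 (fun y => extChartAt 𝓘(ℝ, E) (γ₁ r) (γ y)) r :=
        contDiffAt_extChartAt_comp (by norm_cast) (hsm hγ) (he ▸ hcs)
      exact ((h3.fderiv_right (m := 1) (by norm_num)).clm_apply contDiffAt_const).continuousAt
    refine hF.geodesic_eventuallyEq hJ h₁ h₂ hrJ hval hcs ?_
    by_contra hne
    obtain ⟨y, hy, hy'⟩ := (hfr.and_eventually
      ((hder h₁ rfl).ne_iff_eventually_ne (hder h₂ hval.symm) |>.1 hne)).exists
    exact hy' ((show γ₁ =ᶠ[𝓝 y] γ₂ from hy).fun_comp (extChartAt 𝓘(ℝ, E) (γ₁ r))).deriv_eq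
  exact fun r hr => (show γ₁ =ᶠ[𝓝 r] γ₂ from hsub hr).self_of_nhds

end Isometry

/-! ### Admissible functions and their convexity. -/

section Admissible

variable {k : ℕ} {L : (Fin k → ℝ) → ℝ}

lemma isOpen_forall_pos : IsOpen {t : Fin k → ℝ | ∀ j, 0 < t j} := by
  simp only [ofPred_forall]
  exact isOpen_iInter_of_finite fun j => isOpen_lt continuous_const (continuous_apply j)

lemma IsAdmissible.contDiffAt (hL : IsAdmissible L) {t : Fin k → ℝ} (ht : ∀ j, 0 < t j) :
    ContDiffAt ℝ ∞ L t :=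
  hL.smooth.contDiffAt (isOpen_forall_pos.mem_nhds ht)

lemma IsAdmissible.contDiffAt_comp_sqrt (hL : IsAdmissible L) {r : Fin k → ℝ}
    (hr : ∀ j, 0 < r j) : ContDiffAt ℝ ∞ (fun r : Fin k → ℝ => L fun j => √(r j)) r := by
  have h : ContDiffAt ℝ ∞ (fun r : Fin k → ℝ => fun j => √(r j)) r :=
    contDiffAt_pi.2 fun j => (contDiff_apply ℝ ℝ j).contDiffAt.sqrt (hr j).ne'
  exact (hL.contDiffAt (t := fun j => √(r j)) fun j => Real.sqrt_pos.2 (hr j)).comp r h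

lemma IsAdmissible.exists_partial_pos (hL : IsAdmissible L) {t : Fin k → ℝ} (ht : ∀ j, 0 < t j) :
    ∃ j, 0 < fderiv ℝ L t (Pi.single j 1) := by
  by_contra! h
  exact (hL.partial_sum_pos t ht).not_ge (Finset.sum_nonpos fun j _ => h j)

/-- These are the coefficients of the osculating metric; they have the signs of the partial
derivatives of `L`. -/
lemma IsAdmissible.fderiv_comp_sqrt (hL : IsAdmissible L) {r : Fin k → ℝ} (hr : ∀ j, 0 < r j)
    (j : Fin k) : fderiv ℝ (fun r : Fin k → ℝ => L fun j => √(r j)) r (Pi.single j 1) =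
      fderiv ℝ L (fun j => √(r j)) (Pi.single j 1) * (1 / (2 * √(r j))) := by
  have h : HasFDerivAt (fun r : Fin k → ℝ => fun j => √(r j)) (ContinuousLinearMap.pi fun j =>
      (1 / (2 * √(r j))) • ContinuousLinearMap.proj (R := ℝ) (φ := fun _ : Fin k => ℝ) j) r :=
    hasFDerivAt_pi.2 fun j => (hasFDerivAt_apply j r).sqrt (hr j).ne'
  have h2 : HasFDerivAt (fun r : Fin k → ℝ => L fun j => √(r j)) _ r :=
    ((hL.contDiffAt (t := fun j => √(r j))
      fun j => Real.sqrt_pos.2 (hr j)).differentiableAt (by simp)).hasFDerivAt.comp r h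
  rw [h2.fderiv, ContinuousLinearMap.comp_apply, apply_eq_sum_single,
    Finset.sum_eq_single j (fun i _ hi => by simp [hi]) (by simp)]
  simp

/-- Convexity of `L(√q₁, …, √q_k)` for positive quadratic polynomials `q_j` with negative
discriminant. -/
lemma IsAdmissible.deriv_deriv_pos (hL : IsAdmissible L) {A B C : Fin k → ℝ} (hA : ∀ j, 0 < A j)
    (hABC : ∀ j, 0 < A j * C j - B j ^ 2) :
    0 < deriv (deriv fun t : ℝ => L fun j => √(A j + 2 * t * B j + t ^ 2 * C j)) 0 := by
  have hq : ∀ j, ∀ t : ℝ, HasDerivAt (fun t : ℝ => A j + 2 * t * B j + t ^ 2 * C j)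
      (2 * (B j + t * C j)) t := fun j t => by
    have h1 := (((hasDerivAt_id t).const_mul 2).mul_const (B j)).const_add (A j)
    have h2 := h1.add ((hasDerivAt_pow 2 t).mul_const (C j))
    refine h2.congr_deriv ?_
    norm_num
    ring
  have hpos : ∀ᶠ t in 𝓝 (0 : ℝ), ∀ j, 0 < A j + 2 * t * B j + t ^ 2 * C j := by
    refine eventually_all.2 fun j => ?_
    exact (hq j 0).continuousAt.eventually (lt_mem_nhds (by simpa using hA j))
  have hn : ∀ᶠ t in 𝓝 (0 : ℝ), ∀ j, HasDerivAt (fun t : ℝ => √(A j + 2 * t * B j + t ^ 2 * C j))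
      ((B j + t * C j) / √(A j + 2 * t * B j + t ^ 2 * C j)) t := by
    filter_upwards [hpos] with t ht j
    refine ((hq j t).sqrt (ht j).ne').congr_deriv ?_
    rw [mul_div_mul_left _ _ two_ne_zero]
  set n : ℝ → Fin k → ℝ := fun t j => √(A j + 2 * t * B j + t ^ 2 * C j)
  have hn0 : ∀ j, 0 < n 0 j := fun j => by simpa [n] using hA j
  have hnc : ContinuousAt n 0 := continuousAt_pi.2 fun j => (hn.self_of_nhds j).continuousAt
  have hsm := hL.contDiffAt hn0
  have h1 : (deriv fun t => L (n t)) =ᶠ[𝓝 0] fun t => fderiv ℝ L (n t) fun j =>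
      (B j + t * C j) / n t j := by
    filter_upwards [hn, hnc.eventually (eventually_differentiableAt hsm)] with t ht ht'
    exact (ht'.hasFDerivAt.comp_hasDerivAt t (hasDerivAt_pi.2 ht)).deriv
  rw [h1.deriv_eq]
  have h2 : HasDerivAt (fun t => fderiv ℝ L (n t)) _ 0 :=
    (hasFDerivAt_fderiv hsm).comp_hasDerivAt 0 (hasDerivAt_pi.2 hn.self_of_nhds)
  -- The second derivative of the root of the quadratic is `(AC - B²) / n³`, which is positive by
  -- the discriminant condition.
  have h3 : HasDerivAt (fun t => fun j => (B j + t * C j) / n t j)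
      (fun j => (A j * C j - B j ^ 2) / n 0 j ^ 3) 0 := by
    refine hasDerivAt_pi.2 fun j => ?_
    have h4 : HasDerivAt (fun t : ℝ => B j + t * C j) (C j) 0 := by
      simpa using ((hasDerivAt_id (0 : ℝ)).mul_const (C j)).const_add (B j)
    have h5 := h4.fun_div (hn.self_of_nhds j) (hn0 j).ne'
    refine h5.congr_deriv ?_
    have h6 : A j = n 0 j ^ 2 := by simp [n, Real.sq_sqrt (hA j).le]
    have h7 := (hn0 j).ne'
    have h8 : √(A j + 2 * 0 * B j + 0 ^ 2 * C j) = n 0 j := rfl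
    rw [h8]
    field_simp
    rw [h6]
    ring
  rw [(h2.clm_apply h3).deriv, apply_eq_sum_single (fderiv ℝ L (n 0))]
  -- The Hessian of `L` may be degenerate; strict positivity comes from the gradient term.
  refine add_pos_of_nonneg_of_pos (hL.hessian_nonneg _ hn0 _) ?_
  obtain ⟨i, hi⟩ := hL.exists_partial_pos hn0
  have hpos' : ∀ j, 0 < (A j * C j - B j ^ 2) / n 0 j ^ 3 := fun j =>
    div_pos (hABC j) (pow_pos (hn0 j) 3)
  exact Finset.sum_pos' (fun j _ => mul_nonneg (hL.partial_nonneg _ hn0 j) (hpos' j).le)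
    ⟨i, Finset.mem_univ i, mul_pos hi (hpos' i)⟩

/-- For this function `√L(√g) = √g`, so a Riemannian norm is the case `k = 1` of the combined
metrics. -/
lemma isAdmissible_sq : IsAdmissible fun t : Fin 1 → ℝ => t 0 ^ 2 := by
  have h1 : fderiv ℝ (fun t : Fin 1 → ℝ => t 0 ^ 2) = fun t =>
      (2 * t 0) • ContinuousLinearMap.proj (R := ℝ) (φ := fun _ : Fin 1 => ℝ) 0 := by
    funext t
    simpa using ((hasFDerivAt_apply (𝕜 := ℝ) (0 : Fin 1) t).pow 2).fderiv
  have h2 : ∀ t w : Fin 1 → ℝ, fderiv ℝ (fun t : Fin 1 → ℝ =>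
      (2 * t 0) • ContinuousLinearMap.proj (R := ℝ) (φ := fun _ : Fin 1 => ℝ) 0) t w w =
      2 * w 0 ^ 2 := fun t w => by
    rw [(((hasFDerivAt_apply (𝕜 := ℝ) (0 : Fin 1) t).const_mul 2).smul_const
      (ContinuousLinearMap.proj (R := ℝ) (φ := fun _ : Fin 1 => ℝ) 0)).fderiv]
    simp
    ring
  refine ⟨by fun_prop, by fun_prop, fun t ht => pow_pos (ht 0) 2, fun t c _ _ => ?_, fun t ht j => ?_,
    fun t ht w => ?_, fun t ht => ?_⟩
  · simp [mul_pow]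
  · rw [h1, Subsingleton.elim j 0]
    simpa using (ht 0).le
  · rw [h1, h2]
    positivity
  · rw [h1]
    simpa using ht 0

end Admissible

/-! ### The combined metric is a Finsler metric; conic combinations of Riemannian metrics. -/

section Combined

variable {E : Type*} [NormedAddCommGroup E] [NormedSpace ℝ E]
  {M : Type*} [TopologicalSpace M] [ChartedSpace E M]

open Bundle

/-- With equal arguments the function depends on `a + b` only, so the mixed derivative is an
ordinary second derivative along a line, which is easier to estimate. -/
lemma fundamentalTensor_self (F : ∀ x : M, TangentSpace 𝓘(ℝ, E) x → ℝ) (x : M)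
    (v w : TangentSpace 𝓘(ℝ, E) x) :
    fundamentalTensor F x v w w = (1 / 2) * deriv (deriv fun t : ℝ => F x (v + t • w) ^ 2) 0 := by
  unfold fundamentalTensor
  congr 2
  funext a
  have h : (fun b : ℝ => F x (v + a • w + b • w) ^ 2) =
      fun b => (fun t : ℝ => F x (v + t • w) ^ 2) (a + b) := by
    funext b
    simp only [add_smul, add_assoc]
  rw [h, deriv_comp_const_add (fun t : ℝ => F x (v + t • w) ^ 2), add_zero]

variable [IsManifold 𝓘(ℝ, E) ∞ M]

lemma contMDiff_inner_self
    (g : ContMDiffRiemannianMetric 𝓘(ℝ, E) ∞ E (TangentSpace 𝓘(ℝ, E) (M := M))) :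
    ContMDiff 𝓘(ℝ, E).tangent 𝓘(ℝ, ℝ) ∞
      (fun X : TangentBundle 𝓘(ℝ, E) M => g.inner X.proj X.snd X.snd) := by
  intro X
  have hv : ContMDiffAt 𝓘(ℝ, E).tangent 𝓘(ℝ, E).tangent ∞
      (fun X : TangentBundle 𝓘(ℝ, E) M => TotalSpace.mk' E X.proj X.snd) X := contMDiffAt_id
  have hb : ContMDiffAt 𝓘(ℝ, E).tangent 𝓘(ℝ, E) ∞
      (fun X : TangentBundle 𝓘(ℝ, E) M => X.proj) X := contMDiffAt_proj _
  have : ContMDiffAt 𝓘(ℝ, E).tangent (𝓘(ℝ, E).prod 𝓘(ℝ)) ∞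
      (fun X : TangentBundle 𝓘(ℝ, E) M => TotalSpace.mk' ℝ (E := Bundle.Trivial M ℝ) X.proj
        (g.inner X.proj X.snd X.snd)) X := by
    apply ContMDiffAt.clm_bundle_apply₂ (F₁ := E) (F₂ := E)
    · exact g.contMDiff.contMDiffAt.comp X hb
    · exact hv
    · exact hv
  rw [contMDiffAt_totalSpace] at this
  exact this.2

variable {k : ℕ} {L : (Fin k → ℝ) → ℝ}
  {g : Fin k → ContMDiffRiemannianMetric 𝓘(ℝ, E) ∞ E (TangentSpace 𝓘(ℝ, E) (M := M))}

lemma riemannianNorm_pos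
    (g : ContMDiffRiemannianMetric 𝓘(ℝ, E) ∞ E (TangentSpace 𝓘(ℝ, E) (M := M))) {x : M}
    {v : TangentSpace 𝓘(ℝ, E) x} (hv : v ≠ 0) : 0 < riemannianNorm g x v :=
  Real.sqrt_pos.2 (g.pos x v hv)

lemma riemannianNorm_sq
    (g : ContMDiffRiemannianMetric 𝓘(ℝ, E) ∞ E (TangentSpace 𝓘(ℝ, E) (M := M))) (x : M)
    (v : TangentSpace 𝓘(ℝ, E) x) : riemannianNorm g x v ^ 2 = g.inner x v v := by
  refine Real.sq_sqrt ?_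
  by_cases hv : v = 0
  · simp [hv]
  · exact (g.pos x v hv).le

lemma combinedMetric_sq (hL : IsAdmissible L) {x : M} {v : TangentSpace 𝓘(ℝ, E) x} (hv : v ≠ 0) :
    combinedMetric L g x v ^ 2 = L fun j => riemannianNorm (g j) x v :=
  Real.sq_sqrt (hL.pos _ fun j => riemannianNorm_pos (g j) hv).le

lemma combinedMetric_smul (hL : IsAdmissible L) (x : M) (v : TangentSpace 𝓘(ℝ, E) x) {c : ℝ}
    (hc : 0 < c) : combinedMetric L g x (c • v) = c * combinedMetric L g x v := by
  have h : (fun j => riemannianNorm (g j) x (c • v)) = c • fun j => riemannianNorm (g j) x v := by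
    funext j
    have h2 : (g j).inner x (c • v) (c • v) = c ^ 2 * (g j).inner x v v := by
      simp; ring
    simp only [riemannianNorm, Pi.smul_apply, smul_eq_mul]
    rw [h2, Real.sqrt_mul (sq_nonneg c), Real.sqrt_sq hc.le]
  unfold combinedMetric
  rw [h, hL.homogeneous (fun j => riemannianNorm (g j) x v) c (fun j => Real.sqrt_nonneg _) hc, Real.sqrt_mul (sq_nonneg c),
    Real.sqrt_sq hc.le]

lemma contMDiffOn_combinedMetric (hL : IsAdmissible L) :
    ContMDiffOn 𝓘(ℝ, E).tangent 𝓘(ℝ, ℝ) ∞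
      (fun X : TangentBundle 𝓘(ℝ, E) M => combinedMetric L g X.proj X.snd) {X | X.snd ≠ 0} := by
  intro X hX
  have hpos : ∀ j, 0 < (g j).inner X.proj X.snd X.snd := fun j => (g j).pos _ _ hX
  have h1 : ContMDiffAt 𝓘(ℝ, E).tangent 𝓘(ℝ, Fin k → ℝ) ∞ (fun X : TangentBundle 𝓘(ℝ, E) M =>
      fun j => (g j).inner X.proj X.snd X.snd) X :=
    contMDiffAt_pi_space.2 fun j => (contMDiff_inner_self (g j)).contMDiffAt
  have h2 := (hL.contDiffAt_comp_sqrt hpos).sqrt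
    (hL.pos _ fun j => Real.sqrt_pos.2 (hpos j)).ne'
  exact (h2.contMDiffAt.comp X h1).contMDiffWithinAt

/-- Strict Cauchy–Schwarz: the component of `w` orthogonal to `v` is nonzero and has positive
length. -/
lemma inner_mul_inner_sub_sq_pos
    (g : ContMDiffRiemannianMetric 𝓘(ℝ, E) ∞ E (TangentSpace 𝓘(ℝ, E) (M := M))) {x : M}
    {v w : TangentSpace 𝓘(ℝ, E) x} (hv : v ≠ 0) (h : ∀ c : ℝ, w ≠ c • v) :
    0 < g.inner x v v * g.inner x w w - g.inner x v w ^ 2 := by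
  have hA := g.pos x v hv
  set A := g.inner x v v
  set B := g.inner x v w
  have h1 := g.pos x (w - (B / A) • v) (sub_ne_zero.2 (h _))
  have h2 : g.inner x (w - (B / A) • v) (w - (B / A) • v) =
      g.inner x w w - 2 * (B / A) * B + (B / A) ^ 2 * A := by
    simp [g.symm x w v, A, B]
    ring
  rw [h2] at h1
  have h3 : g.inner x w w - 2 * (B / A) * B + (B / A) ^ 2 * A = (A * g.inner x w w - B ^ 2) / A := by
    field_simp; ring
  rw [h3] at h1
  exact (div_pos_iff_of_pos_right hA).1 h1

lemma isFinslerMetric_combinedMetric (hL : IsAdmissible L) :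
    IsFinslerMetric (combinedMetric L g) where
  smooth := contMDiffOn_combinedMetric hL
  pos x v hv := Real.sqrt_pos.2 (hL.pos _ fun j => riemannianNorm_pos (g j) hv)
  homogeneous x v c hc := combinedMetric_smul hL x v hc
  strongly_convex x v w hv hw := by
    rw [fundamentalTensor_self]
    refine mul_pos (by norm_num) ?_
    by_cases hpar : ∃ c : ℝ, w = c • v
    · obtain ⟨c, rfl⟩ := hpar
      have hc : c ≠ 0 := fun h => hw (by simp [h])
      set m := combinedMetric L g x v ^ 2
      have hm : 0 < m := pow_pos (Real.sqrt_pos.2 (hL.pos _ fun j => riemannianNorm_pos (g j) hv)) 2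
      -- Along `v` itself Cauchy–Schwarz is an equality, so convexity has to come from homogeneity,
      -- which applies while `1 + t c > 0`.
      have h1 : (fun t : ℝ => combinedMetric L g x (v + t • c • v) ^ 2) =ᶠ[𝓝 0]
          fun t => (1 + t * c) ^ 2 * m := by
        have hcont : ContinuousAt (fun t : ℝ => 1 + t * c) 0 := by fun_prop
        filter_upwards [hcont.eventually (lt_mem_nhds (a := 0) (by simp))] with t ht
        have : v + t • c • v = (1 + t * c) • v := by rw [add_smul, one_smul, smul_smul]
        rw [this, combinedMetric_smul hL x v ht, mul_pow]
      have h2 : deriv (fun t : ℝ => (1 + t * c) ^ 2 * m) = fun t => 2 * c * (1 + t * c) * m := by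
        funext t
        have h3 : HasDerivAt (fun t : ℝ => 1 + t * c) c t := by
          simpa using ((hasDerivAt_id t).mul_const c).const_add 1
        rw [((h3.fun_pow 2).mul_const m).deriv]
        simp only [Nat.cast_ofNat, Nat.add_one_sub_one, pow_one]
        ring
      have h4 : HasDerivAt (fun t : ℝ => 2 * c * (1 + t * c) * m) (2 * c * c * m) 0 := by
        have h3 : HasDerivAt (fun t : ℝ => 1 + t * c) c 0 := by
          simpa using ((hasDerivAt_id (0 : ℝ)).mul_const c).const_add 1
        exact (h3.const_mul (2 * c)).mul_const m
      rw [h1.deriv.deriv_eq, h2, h4.deriv]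
      have := mul_self_pos.2 hc
      nlinarith [mul_pos this hm]
    · push Not at hpar
      have hne : ∀ t : ℝ, v + t • w ≠ 0 := fun t h => by
        by_cases ht : t = 0
        · exact hv (by simpa [ht] using h)
        · apply hpar (-t⁻¹)
          have : t • w = -v := eq_neg_of_add_eq_zero_right h
          rw [neg_smul, ← smul_neg, ← this, smul_smul, inv_mul_cancel₀ ht, one_smul]
      have h1 : (fun t : ℝ => combinedMetric L g x (v + t • w) ^ 2) = fun t =>
          L fun j => √((g j).inner x v v + 2 * t * (g j).inner x v w
            + t ^ 2 * (g j).inner x w w) := by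
        funext t
        rw [combinedMetric_sq hL (hne t)]
        congr 1
        funext j
        unfold riemannianNorm
        congr 1
        simp [(g j).symm x w v]
        ring
      rw [h1]
      exact hL.deriv_deriv_pos (fun j => (g j).pos x v hv)
        fun j => inner_mul_inner_sub_sq_pos (g j) hv hpar

lemma isFinslerMetric_riemannianNorm
    (g : ContMDiffRiemannianMetric 𝓘(ℝ, E) ∞ E (TangentSpace 𝓘(ℝ, E) (M := M))) :
    IsFinslerMetric (riemannianNorm g) := by
  have h : riemannianNorm g = combinedMetric (fun t : Fin 1 → ℝ => t 0 ^ 2) fun _ => g := by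
    funext x v
    exact (Real.sqrt_sq (Real.sqrt_nonneg _)).symm
  rw [h]
  exact isFinslerMetric_combinedMetric isAdmissible_sq

/-- A nontrivial linear combination of Riemannian metrics with nonnegative coefficients. -/
noncomputable def conicCombination
    (g : Fin k → ContMDiffRiemannianMetric 𝓘(ℝ, E) ∞ E (TangentSpace 𝓘(ℝ, E) (M := M)))
    (c : Fin k → ℝ) (hc : ∀ j, 0 ≤ c j) (i : Fin k) (hi : 0 < c i) :
    ContMDiffRiemannianMetric 𝓘(ℝ, E) ∞ E (TangentSpace 𝓘(ℝ, E) (M := M)) where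
  inner x := ∑ j, c j • (g j).inner x
  symm x v w := by simp [(g _).symm x v w]
  pos x v hv := by
    simp only [sum_apply, smul_apply, smul_eq_mul]
    exact Finset.sum_pos' (fun j _ => mul_nonneg (hc j) ((g j).pos x v hv).le)
      ⟨i, Finset.mem_univ i, mul_pos hi ((g i).pos x v hv)⟩
  isVonNBounded x := by
    -- Since `c i * g i` is at most the combination, the unit ball of the combination lies in that
    -- of `g i` scaled by `1 / √(c i)`.
    have h1 := ((g i).isVonNBounded x).image
      ((√(c i))⁻¹ • ContinuousLinearMap.id ℝ (TangentSpace 𝓘(ℝ, E) x))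
    refine h1.subset ?_
    intro v hv
    refine ⟨√(c i) • v, ?_, ?_⟩
    · have h2 : c i * (g i).inner x v v ≤ ∑ j, c j * (g j).inner x v v :=
        Finset.single_le_sum (f := fun j => c j * (g j).inner x v v) (fun j _ =>
          mul_nonneg (hc j) (by rw [← riemannianNorm_sq]; positivity)) (Finset.mem_univ i)
      have h3 : ∑ j, c j * (g j).inner x v v < 1 := by
        simpa [sum_apply] using hv
      have h4 : (g i).inner x (√(c i) • v) (√(c i) • v) = c i * (g i).inner x v v := by
        simp only [map_smul, smul_apply, smul_eq_mul]
        rw [← mul_assoc, Real.mul_self_sqrt hi.le]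
      simp only [mem_ofPred_eq, h4]
      linarith
    · have : √(c i) ≠ 0 := (Real.sqrt_pos.2 hi).ne'
      simp [smul_smul, this]
  contMDiff := by
    have h := ContMDiff.sum_section (I := 𝓘(ℝ, E)) (n := ∞) (F := E →L[ℝ] E →L[ℝ] ℝ)
      (s := Finset.univ) (t := fun (j : Fin k) (x : M) => c j • (g j).inner x)
      fun j _ => (contMDiff_const (c := c j)).smul_section (g j).contMDiff
    simpa only [Finset.sum_apply] using h

lemma isInvariantMetric_combinedMetric {G : Type*} [Group G] [MulAction G M]
    (hg : ∀ j, IsInvariantMetric G (riemannianNorm (g j))) :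
    IsInvariantMetric G (combinedMetric L g) := by
  intro σ x v
  unfold combinedMetric
  congr 2
  funext j
  exact hg j σ x v

end Combined

/-! ### Orbits of one-parameter groups of isometries. -/

lemma EulerLagrangeAt.congr {E : Type*} [NormedAddCommGroup E] [NormedSpace ℝ E]
    {e e' : E × E → ℝ} {p : E × E} {a : E} (h : EulerLagrangeAt e p a) (hee : e' =ᶠ[𝓝 p] e) :
    EulerLagrangeAt e' p a := by
  intro w
  rw [hee.fderiv.fderiv_eq, hee.fderiv_eq]
  exact h w

lemma smul_orbit {G M : Type*} [Group G] [MulAction G M] (φ : Multiplicative ℝ →* G) (q : M) (h t : ℝ) :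
    φ (Multiplicative.ofAdd h) • φ (Multiplicative.ofAdd t) • q =
      φ (Multiplicative.ofAdd (t + h)) • q := by
  rw [smul_smul, ← map_mul, ← ofAdd_add, add_comm]

section Orbit

variable {EG : Type*} [NormedAddCommGroup EG] [NormedSpace ℝ EG]
  {E : Type*} [NormedAddCommGroup E] [NormedSpace ℝ E]
  {G : Type*} [TopologicalSpace G] [ChartedSpace EG G] [Group G]
  {M : Type*} [TopologicalSpace M] [ChartedSpace E M] [MulAction G M]

lemma IsInvariantMetric.isMetricPreserving [ContMDiffSMul 𝓘(ℝ, EG) 𝓘(ℝ, E) ∞ G M]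
    {F : ∀ x : M, TangentSpace 𝓘(ℝ, E) x → ℝ} (hF : IsInvariantMetric G F) (σ : G) :
    IsMetricPreserving F fun x => σ • x :=
  ⟨ContMDiffSMul.contMDiff_const_smul (I := 𝓘(ℝ, EG)) σ, hF σ⟩

lemma contMDiff_orbit [ContMDiffSMul 𝓘(ℝ, EG) 𝓘(ℝ, E) ∞ G M] {φ : Multiplicative ℝ →* G}
    (hφ : ContMDiff 𝓘(ℝ, ℝ) 𝓘(ℝ, EG) ∞ fun t : ℝ => φ (Multiplicative.ofAdd t)) (q : M) :
    ContMDiff 𝓘(ℝ, ℝ) 𝓘(ℝ, E) ∞ fun t : ℝ => φ (Multiplicative.ofAdd t) • q :=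
  hφ.smul (I := 𝓘(ℝ, EG)) contMDiff_const

variable [IsManifold 𝓘(ℝ, E) ∞ M] [ContMDiffSMul 𝓘(ℝ, EG) 𝓘(ℝ, E) ∞ G M]
  {F : ∀ x : M, TangentSpace 𝓘(ℝ, E) x → ℝ} {φ : Multiplicative ℝ →* G} {q : M} {t₀ : ℝ} {c : M}

/-- An orbit of a one-parameter group of isometries that satisfies the geodesic equation at one
time is a geodesic. -/
lemma IsFinslerMetric.isGeodesicOn_orbit (hF : IsFinslerMetric F) (hinv : IsInvariantMetric G F)
    (hφ : ContMDiff 𝓘(ℝ, ℝ) 𝓘(ℝ, EG) ∞ fun t : ℝ => φ (Multiplicative.ofAdd t))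
    (hc : φ (Multiplicative.ofAdd t₀) • q ∈ (extChartAt 𝓘(ℝ, E) c).source)
    (hne : deriv (fun t => extChartAt 𝓘(ℝ, E) c (φ (Multiplicative.ofAdd t) • q)) t₀ ≠ 0)
    (h : GeodesicEquationAt F c (fun t => φ (Multiplicative.ofAdd t) • q) t₀) :
    IsGeodesicOn F (fun t => φ (Multiplicative.ofAdd t) • q) univ := by
  have hsm := contMDiff_orbit (E := E) hφ q
  set γ : ℝ → M := fun t => φ (Multiplicative.ofAdd t) • q
  -- Acting by `φ(t₀ - t)` reparametrizes the orbit by a shift that takes the time `t` to `t₀`; both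
  -- regularity and the geodesic equation at `t` are pulled back from `t₀`.
  have hshift : ∀ t, (fun r => φ (Multiplicative.ofAdd (t₀ - t)) • γ r) =
      fun r => γ (r + (t₀ - t)) := fun t => funext fun r => smul_orbit φ q _ r
  have hsm2 : ∀ t, ContMDiffAt 𝓘(ℝ, ℝ) 𝓘(ℝ, E) 2 γ t := fun t =>
    (hsm t).of_le (by norm_cast)
  have hd1 : ∀ t, deriv (fun r => extChartAt 𝓘(ℝ, E) c (γ (r + (t₀ - t)))) =
      fun r => deriv (fun r => extChartAt 𝓘(ℝ, E) c (γ r)) (r + (t₀ - t)) := fun t =>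
    funext fun r => deriv_comp_add_const (fun r => extChartAt 𝓘(ℝ, E) c (γ r)) _ r
  have hct : ∀ t, φ (Multiplicative.ofAdd (t₀ - t)) • γ t ∈ (extChartAt 𝓘(ℝ, E) c).source := by
    intro t
    rw [congrFun (hshift t) t]
    simpa using hc
  have hsmul : ∀ t, ContMDiff 𝓘(ℝ, E) 𝓘(ℝ, E) ∞ fun x : M =>
      φ (Multiplicative.ofAdd (t₀ - t)) • x := fun t => (hinv.isMetricPreserving (EG := EG) _).smooth
  have hne' : ∀ t, mfderiv 𝓘(ℝ, ℝ) 𝓘(ℝ, E)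
      (fun r => φ (Multiplicative.ofAdd (t₀ - t)) • γ r) t ≠ 0 := fun t => by
    refine mfderiv_curve_ne_zero (c := c) (((hsmul t _).comp t (hsm t)).mdifferentiableAt (by simp))
      (hct t) ?_
    have h1 : (fun r => extChartAt 𝓘(ℝ, E) c (φ (Multiplicative.ofAdd (t₀ - t)) • γ r)) =
        fun r => extChartAt 𝓘(ℝ, E) c (γ (r + (t₀ - t))) :=
      funext fun r => congrArg _ (congrFun (hshift t) r)
    rw [h1, hd1]
    simpa using hne
  refine (hF.isGeodesicOn_iff isOpen_univ).2
    ⟨fun t _ => (hsm2 t).contMDiffWithinAt, fun t _ h0 => hne' t ?_, fun c' t _ hc' => ?_⟩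
  · have h1 := mfderiv_comp t ((hsmul t (γ t)).mdifferentiableAt (by simp))
      ((hsm t).mdifferentiableAt (by simp))
    rw [h0, ContinuousLinearMap.comp_zero] at h1
    exact h1
  · refine GeodesicEquationAt.of_isMetricPreserving hF
      (hinv.isMetricPreserving (EG := EG) (φ (Multiplicative.ofAdd (t₀ - t)))) (hsm2 t) hc' (hct t) (hne' t) ?_
    rw [hshift]
    unfold GeodesicEquationAt at h ⊢
    rw [hd1, deriv_comp_add_const (deriv fun r => extChartAt 𝓘(ℝ, E) c (γ r))]
    simpa using h

/-- The energy is stationary along the orbits of a one-parameter group of isometries. -/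
lemma IsFinslerMetric.fderiv_chartEnergy_orbit (hF : IsFinslerMetric F)
    (hinv : IsInvariantMetric G F)
    (hφ : ContMDiff 𝓘(ℝ, ℝ) 𝓘(ℝ, EG) ∞ fun t : ℝ => φ (Multiplicative.ofAdd t))
    (hc : φ (Multiplicative.ofAdd t₀) • q ∈ (extChartAt 𝓘(ℝ, E) c).source)
    (hne : deriv (fun t => extChartAt 𝓘(ℝ, E) c (φ (Multiplicative.ofAdd t) • q)) t₀ ≠ 0) :
    let x : ℝ → E := fun t => extChartAt 𝓘(ℝ, E) c (φ (Multiplicative.ofAdd t) • q)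
    fderiv ℝ (chartEnergy F c) (x t₀, deriv x t₀) (deriv x t₀, deriv (deriv x) t₀) = 0 := by
  intro x
  have hsm := contMDiff_orbit (E := E) hφ q
  have hsm2 : ContMDiffAt 𝓘(ℝ, ℝ) 𝓘(ℝ, E) 2
      (fun t : ℝ => φ (Multiplicative.ofAdd t) • q) t₀ := (hsm t₀).of_le (by norm_cast)
  -- The isometry `φ(t - t₀)` carries the velocity of the orbit at `t₀` to that at `t`, so the
  -- energy is constant.
  have hconst : (fun t => chartEnergy F c (x t, deriv x t)) =ᶠ[𝓝 t₀]
      fun _ => chartEnergy F c (x t₀, deriv x t₀) := by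
    filter_upwards [hsm.continuous.continuousAt.preimage_mem_nhds
      ((isOpen_extChartAt_source c).mem_nhds hc)] with t ht
    have hshift : ∀ r, φ (Multiplicative.ofAdd (t - t₀)) • φ (Multiplicative.ofAdd r) • q =
      φ (Multiplicative.ofAdd (r + (t - t₀))) • q := fun r => smul_orbit φ q _ r
    have h1 := (hinv.isMetricPreserving (EG := EG) (φ (Multiplicative.ofAdd (t - t₀)))).chartEnergy_curve
      hsm2 hc (c' := c) (by rw [hshift]; simpa using ht)
    simp only [hshift] at h1
    rw [deriv_comp_add_const x, add_sub_cancel] at h1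
    exact h1.symm
  have hx : ContDiffAt ℝ 2 x t₀ := contDiffAt_extChartAt_comp (by norm_cast) hsm2 hc
  have hx' : DifferentiableAt ℝ (deriv x) t₀ :=
    ((hx.fderiv_right (m := 1) (by norm_num)).clm_apply contDiffAt_const).differentiableAt
      (by norm_num)
  have he : HasFDerivAt (chartEnergy F c) (fderiv ℝ (chartEnergy F c) (x t₀, deriv x t₀))
      (x t₀, deriv x t₀) :=
    ((hF.contDiffAt_chartEnergy (q := (x t₀, deriv x t₀))
      ((extChartAt 𝓘(ℝ, E) c).map_source hc) hne).differentiableAt (by simp)).hasFDerivAt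
  have h2 := he.comp_hasDerivAt (f := fun t => (x t, deriv x t)) t₀
    ((hx.differentiableAt (by norm_num)).hasDerivAt.prodMk hx'.hasDerivAt)
  exact h2.unique ((hasDerivAt_const t₀ _).congr_of_eventuallyEq hconst)

end Orbit

/-! ### The osculating metric and the geodesic orbit property. -/

section Main

open Bundle

variable {EG : Type*} [NormedAddCommGroup EG] [NormedSpace ℝ EG]
  {E : Type*} [NormedAddCommGroup E] [NormedSpace ℝ E]
  {G : Type*} [TopologicalSpace G] [ChartedSpace EG G] [Group G]
  {M : Type*} [TopologicalSpace M] [ChartedSpace E M] [MulAction G M] [IsManifold 𝓘(ℝ, E) ∞ M]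
  {k : ℕ} {L : (Fin k → ℝ) → ℝ}
  {g : Fin k → ContMDiffRiemannianMetric 𝓘(ℝ, E) ∞ E (TangentSpace 𝓘(ℝ, E) (M := M))}

lemma conicCombination_inner {c : Fin k → ℝ} {hc : ∀ j, 0 ≤ c j} {i : Fin k} {hi : 0 < c i} (x : M)
    (v w : TangentSpace 𝓘(ℝ, E) x) :
    (conicCombination g c hc i hi).inner x v w = ∑ j, c j * (g j).inner x v w := by
  simp [conicCombination]

lemma riemannianNorm_conicCombination_sq {c : Fin k → ℝ} {hc : ∀ j, 0 ≤ c j} {i : Fin k}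
    {hi : 0 < c i} (x : M) (v : TangentSpace 𝓘(ℝ, E) x) :
    riemannianNorm (conicCombination g c hc i hi) x v ^ 2 =
      ∑ j, c j * riemannianNorm (g j) x v ^ 2 := by
  simp only [riemannianNorm_sq, conicCombination_inner]

/-- This places the osculating metric in the family. Invariance is a condition on norms, and it is
checked on their squares, which are linear in the metric. -/
lemma isDiagonalMetric_conicCombination {p : M} {s : ℕ}
    {𝔪i : Fin s → Submodule ℝ (GroupLieAlgebra 𝓘(ℝ, EG) G)}
    {α : ∀ i, 𝔪i i →ₗ[ℝ] 𝔪i i →ₗ[ℝ] ℝ} {a : Fin k → Fin s → ℝ}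
    (hg : ∀ j, IsDiagonalMetric p α (a j) (g j)) {c : Fin k → ℝ} (hc : ∀ j, 0 ≤ c j) {i : Fin k}
    (hi : 0 < c i) :
    IsDiagonalMetric p α (fun l => ∑ j, c j * a j l) (conicCombination g c hc i hi) where
  invariant σ x v := by
    have h0 : ∀ x v, 0 ≤ riemannianNorm (conicCombination g c hc i hi) x v :=
      fun _ _ => Real.sqrt_nonneg _
    refine (sq_eq_sq₀ (h0 _ _) (h0 _ _)).1 ?_
    rw [riemannianNorm_conicCombination_sq, riemannianNorm_conicCombination_sq]
    exact Finset.sum_congr rfl fun j _ => by rw [(hg j).invariant σ x v]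
  inner_eq y z := by
    simp only [conicCombination_inner, (hg _).inner_eq, Finset.mul_sum, Finset.sum_mul]
    rw [Finset.sum_comm]
    simp only [mul_assoc]

/-- If all the conic combinations of invariant Riemannian metrics are geodesic orbit metrics, then
so is every admissible function of these metrics. -/
lemma isGeodesicOrbit_combinedMetric [FiniteDimensional ℝ E] [T2Space M]
    [ContMDiffSMul 𝓘(ℝ, EG) 𝓘(ℝ, E) ∞ G M] (hL : IsAdmissible L) (p : M)
    (hinv : ∀ j, IsInvariantMetric G (riemannianNorm (g j)))
    (hGO : ∀ (c : Fin k → ℝ) (hc : ∀ j, 0 ≤ c j) (i : Fin k) (hi : 0 < c i),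
      IsGeodesicOrbit EG G (riemannianNorm (conicCombination g c hc i hi))) :
    IsGeodesicOrbit EG G (combinedMetric L g) := by
  intro γ J hJ hJ' hγ
  obtain rfl | ⟨t₀, ht₀⟩ := J.eq_empty_or_nonempty
  · exact ⟨1, p, contMDiff_const, fun t ht => ht.elim⟩
  have hF : IsFinslerMetric (combinedMetric L g) := isFinslerMetric_combinedMetric hL
  set F := combinedMetric L g
  have hFinv : IsInvariantMetric G F := isInvariantMetric_combinedMetric hinv
  set ch : M := γ t₀
  have hsrc : γ t₀ ∈ (extChartAt 𝓘(ℝ, E) ch).source := mem_extChartAt_source _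
  have hz := (extChartAt 𝓘(ℝ, E) ch).map_source hsrc
  have hv : deriv (fun r => extChartAt 𝓘(ℝ, E) ch (γ r)) t₀ ≠ 0 := deriv_extChartAt_ne_zero
    ((hγ.smooth.contMDiffAt (hJ.mem_nhds ht₀)).mdifferentiableAt (by norm_num))
    (hγ.regular t₀ ht₀) hsrc
  set P : E × E := (extChartAt 𝓘(ℝ, E) ch (γ t₀),
    deriv (fun r => extChartAt 𝓘(ℝ, E) ch (γ r)) t₀)
  set e : Fin k → E × E → ℝ := fun j => chartEnergy (riemannianNorm (g j)) ch
  have he : ∀ j, ContDiffAt ℝ ∞ (e j) P := fun j =>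
    (isFinslerMetric_riemannianNorm (g j)).contDiffAt_chartEnergy hz hv
  have hpos : ∀ j, 0 < e j P := fun j => pow_pos (riemannianNorm_pos (g j)
    fun h => hv (chartVector_injective hz h)) 2
  set Λ : (Fin k → ℝ) → ℝ := fun r => L fun j => √(r j)
  have hΛ : ContDiffAt ℝ ∞ Λ fun j => e j P := hL.contDiffAt_comp_sqrt hpos
  have hsq : ∀ j, 0 < √(e j P) := fun j => Real.sqrt_pos.2 (hpos j)
  -- The weights depend on the initial vector `P`: they make `ĝ` and `F²` agree to first order in
  -- the energies there, and a different geodesic may need a different `ĝ`.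
  set c : Fin k → ℝ := fun j => fderiv ℝ Λ (fun j => e j P) (Pi.single j 1)
  have hc_eq : ∀ j, c j = fderiv ℝ L (fun j => √(e j P)) (Pi.single j 1) *
      (1 / (2 * √(e j P))) := fun j => hL.fderiv_comp_sqrt hpos j
  have hc : ∀ j, 0 ≤ c j := fun j => by
    rw [hc_eq]
    exact mul_nonneg (hL.partial_nonneg _ hsq j) (by positivity)
  obtain ⟨i, hi⟩ : ∃ i, 0 < c i := by
    obtain ⟨i, hi⟩ := hL.exists_partial_pos hsq
    have := hsq i
    exact ⟨i, by rw [hc_eq]; positivity⟩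
  set ĝ := conicCombination g c hc i hi
  -- A short geodesic of `ĝ` suffices: it is needed only to produce `φ` and `q`, and the orbit is
  -- defined for all times.
  obtain ⟨ε, hε, γ', hγ', hγ'0, hγ'1⟩ :=
    (isFinslerMetric_riemannianNorm ĝ).exists_geodesic ch (q := P) hz hv t₀
  obtain ⟨φ, q, hφ, hq⟩ := hGO c hc i hi γ' _ isOpen_Ioo ordConnected_Ioo hγ'
  refine ⟨φ, q, hφ, ?_⟩
  have ht₀' : t₀ ∈ Ioo (t₀ - ε) (t₀ + ε) := ⟨by linarith, by linarith⟩
  have hloc : γ' =ᶠ[𝓝 t₀] fun t => φ (Multiplicative.ofAdd t) • q := by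
    filter_upwards [isOpen_Ioo.mem_nhds ht₀'] with t ht using hq t ht
  have hlocx := hloc.fun_comp (extChartAt 𝓘(ℝ, E) ch)
  have hval : φ (Multiplicative.ofAdd t₀) • q = γ t₀ := by
    rw [← hq t₀ ht₀', hγ'0]
    exact (extChartAt 𝓘(ℝ, E) ch).left_inv hsrc
  have hder : deriv (fun t => extChartAt 𝓘(ℝ, E) ch (φ (Multiplicative.ofAdd t) • q)) t₀ = P.2 :=
    hlocx.deriv_eq.symm.trans hγ'1
  have hsrc' : φ (Multiplicative.ofAdd t₀) • q ∈ (extChartAt 𝓘(ℝ, E) ch).source := hval ▸ hsrc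
  have hne' : deriv (fun t => extChartAt 𝓘(ℝ, E) ch (φ (Multiplicative.ofAdd t) • q)) t₀ ≠ 0 := by
    rw [hder]; exact hv
  have hPeq : (extChartAt 𝓘(ℝ, E) ch (φ (Multiplicative.ofAdd t₀) • q),
      deriv (fun t => extChartAt 𝓘(ℝ, E) ch (φ (Multiplicative.ofAdd t) • q)) t₀) = P :=
    Prod.ext (by rw [hval]) hder
  have hELg : EulerLagrangeAt (chartEnergy (riemannianNorm ĝ) ch) P (deriv (deriv fun t =>
      extChartAt 𝓘(ℝ, E) ch (φ (Multiplicative.ofAdd t) • q)) t₀) := by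
    have h1 := ((isFinslerMetric_riemannianNorm ĝ).isGeodesicOn_iff isOpen_Ioo).1 hγ' |>.2.2 ch t₀
      ht₀' (by rw [hq t₀ ht₀']; exact hsrc')
    have h2 : (extChartAt 𝓘(ℝ, E) ch (γ' t₀),
        deriv (fun t => extChartAt 𝓘(ℝ, E) ch (γ' t)) t₀) = P :=
      Prod.ext (by rw [hq t₀ ht₀', hval]) hγ'1
    unfold GeodesicEquationAt at h1
    rw [h2] at h1
    have h3 := hlocx.deriv.deriv_eq
    exact h3 ▸ h1
  -- The one-parameter group preserves every `g j` and not only `ĝ`; this is where the invariance of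
  -- the individual metrics enters.
  have hstat : ∀ j, fderiv ℝ (e j) P (P.2, deriv (deriv fun t =>
      extChartAt 𝓘(ℝ, E) ch (φ (Multiplicative.ofAdd t) • q)) t₀) = 0 := fun j => by
    have h1 := (isFinslerMetric_riemannianNorm (g j)).fderiv_chartEnergy_orbit (hinv j) hφ
      hsrc' hne'
    simp only [hPeq] at h1
    rw [hder] at h1
    exact h1
  have hELF : GeodesicEquationAt F ch (fun t => φ (Multiplicative.ofAdd t) • q) t₀ := by
    unfold GeodesicEquationAt
    rw [hPeq]
    refine (eulerLagrangeAt_comp he hΛ hstat (hELg.congr ?_)).congr ?_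
    · refine Eventually.of_forall fun y => ?_
      exact (riemannianNorm_conicCombination_sq _ _).symm
    · have hN : {q : E × E | q.1 ∈ (extChartAt 𝓘(ℝ, E) ch).target ∧ q.2 ≠ 0} ∈ 𝓝 P :=
        (((isOpen_extChartAt_target ch).preimage continuous_fst).inter
          (isOpen_compl_singleton.preimage continuous_snd)).mem_nhds ⟨hz, hv⟩
      filter_upwards [hN] with y hy
      have h1 := combinedMetric_sq (g := g) hL
        (v := chartVector ch y.1 y.2) fun h => hy.2 (chartVector_injective hy.1 h)
      refine h1.trans (congrArg L (funext fun j => ?_))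
      exact (Real.sqrt_sq (Real.sqrt_nonneg _)).symm
  have horb := hF.isGeodesicOn_orbit hFinv hφ hsrc' hne' hELF
  have horbJ : IsGeodesicOn F (fun t => φ (Multiplicative.ofAdd t) • q) J :=
    ⟨horb.smooth.mono (subset_univ J), fun t _ => horb.regular t (mem_univ t),
      fun c t _ => horb.equation c t (mem_univ t)⟩
  exact fun t ht => hF.geodesic_eqOn hJ hJ' hγ horbJ ht₀ hval.symm hsrc hder.symm ht

/-- At `p`, each `g j (y, y)` is a linear form `S j` in the numbers `αᵢ(yᵢ, yᵢ)`. Its coefficients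
are all positive, so `S j > 0` on the closed orthant away from the origin, also where some
coordinates vanish; the square roots are smooth there. -/
lemma isAlphaType_combinedMetric (hL : IsAdmissible L) {p : M} {s : ℕ}
    {𝔪i : Fin s → Submodule ℝ (GroupLieAlgebra 𝓘(ℝ, EG) G)}
    {α : ∀ i, 𝔪i i →ₗ[ℝ] 𝔪i i →ₗ[ℝ] ℝ} {a : Fin k → Fin s → ℝ} (ha : ∀ j i, 0 < a j i)
    (hg : ∀ j, IsDiagonalMetric p α (a j) (g j)) : IsAlphaType p α (combinedMetric L g) := by
  set S : (Fin s → ℝ) → Fin k → ℝ := fun r j => ∑ i, a j i * r i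
  have hS : ContDiff ℝ ∞ S := contDiff_pi.2 fun j => by fun_prop
  refine ⟨fun r => √(L fun j => √(S r j)), ?_, ?_, fun y => ?_⟩
  · refine Real.continuous_sqrt.comp_continuousOn (hL.continuous.comp (t := {t | ∀ j, 0 ≤ t j}) ?_
      fun r _ j => Real.sqrt_nonneg _)
    exact (continuous_pi fun j => Real.continuous_sqrt.comp
      ((continuous_apply j).comp hS.continuous)).continuousOn
  · rintro r ⟨hr, hr0⟩
    obtain ⟨l, hl⟩ : ∃ l, r l ≠ 0 := by
      by_contra! h
      exact hr0 (funext h)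
    have hpos : ∀ j, 0 < S r j := fun j =>
      Finset.sum_pos' (fun i _ => mul_nonneg (ha j i).le (hr i))
        ⟨l, Finset.mem_univ l, mul_pos (ha j l) (lt_of_le_of_ne (hr l) hl.symm)⟩
    exact (((hL.contDiffAt_comp_sqrt hpos).comp r hS.contDiffAt).sqrt
      (hL.pos _ fun j => Real.sqrt_pos.2 (hpos j)).ne').contDiffWithinAt
  · unfold combinedMetric
    congr 2
    funext j
    unfold riemannianNorm
    rw [(hg j).inner_eq]

end Main

end GOFinsler

theorem mainTheorem1
    {EG : Type*} [NormedAddCommGroup EG] [NormedSpace ℝ EG] [FiniteDimensional ℝ EG]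
    {E : Type*} [NormedAddCommGroup E] [NormedSpace ℝ E] [FiniteDimensional ℝ E]
    {G : Type*} [TopologicalSpace G] [T2Space G] [ChartedSpace EG G] [Group G]
    [LieGroup 𝓘(ℝ, EG) ∞ G]
    {M : Type*} [TopologicalSpace M] [T2Space M] [ChartedSpace E M] [IsManifold 𝓘(ℝ, E) ∞ M]
    [MulAction G M] [ContMDiffSMul 𝓘(ℝ, EG) 𝓘(ℝ, E) ∞ G M] [MulAction.IsPretransitive G M]
    (p : M)
    (hproj : Function.Surjective
      (GOFinsler.projDeriv p : GroupLieAlgebra 𝓘(ℝ, EG) G →L[ℝ] TangentSpace 𝓘(ℝ, E) p))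
    (𝔪 : Submodule ℝ (GroupLieAlgebra 𝓘(ℝ, EG) G))
    (h𝔪 : GOFinsler.IsReductiveComplement E p 𝔪)
    {s : ℕ} (𝔪i : Fin s → Submodule ℝ (GroupLieAlgebra 𝓘(ℝ, EG) G))
    (h𝔪i : GOFinsler.IsIrreducibleDecomposition p 𝔪 𝔪i)
    (α : ∀ i, 𝔪i i →ₗ[ℝ] 𝔪i i →ₗ[ℝ] ℝ)
    (hα : ∀ i, GOFinsler.IsInvariantScalarProduct p (α i))
    (hfamily : ∀ c : Fin s → ℝ, (∀ i, 0 < c i) →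
      ∀ g : Bundle.ContMDiffRiemannianMetric 𝓘(ℝ, E) ∞ E (TangentSpace 𝓘(ℝ, E) (M := M)),
        GOFinsler.IsDiagonalMetric p α c g →
          GOFinsler.IsGeodesicOrbit EG G (GOFinsler.riemannianNorm g))
    {k : ℕ} (a : Fin k → Fin s → ℝ) (ha : ∀ j i, 0 < a j i)
    (g : Fin k →
      Bundle.ContMDiffRiemannianMetric 𝓘(ℝ, E) ∞ E (TangentSpace 𝓘(ℝ, E) (M := M)))
    (hg : ∀ j, GOFinsler.IsDiagonalMetric p α (a j) (g j))
    (L : (Fin k → ℝ) → ℝ) (hL : GOFinsler.IsAdmissible L) :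
    GOFinsler.IsFinslerMetric (GOFinsler.combinedMetric L g) ∧
    GOFinsler.IsInvariantMetric G (GOFinsler.combinedMetric L g) ∧
    GOFinsler.IsGeodesicOrbit EG G (GOFinsler.combinedMetric L g) ∧
    GOFinsler.IsAlphaType p α (GOFinsler.combinedMetric L g) := by
  refine ⟨GOFinsler.isFinslerMetric_combinedMetric hL,
    GOFinsler.isInvariantMetric_combinedMetric fun j => (hg j).invariant,
    GOFinsler.isGeodesicOrbit_combinedMetric hL p (fun j => (hg j).invariant)
      fun c hc i hi => hfamily (fun l => ∑ j, c j * a j l) (fun l => ?_) _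
        (GOFinsler.isDiagonalMetric_conicCombination hg hc hi),
    GOFinsler.isAlphaType_combinedMetric hL ha hg⟩
  -- Some weights `c j` may vanish; the positive one, `c i`, already makes each coefficient of the
  -- combination positive.
  exact Finset.sum_pos' (fun j _ => mul_nonneg (hc j) (ha j l).le)
    ⟨i, Finset.mem_univ i, mul_pos hi (ha i l)⟩
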